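/- Let $1\le p<\infty$, let $m$ be normalized arc length measure on the unit circle $\mathbb T$, let $E\subset\mathbb T$ be closed with $m(E)=0$, and let $\Lambda\subset\mathbb N_0$ be infinite. Let $H^p$ be the Banach space of all holomorphic functions $f$ on the open unit disc with $\|f\|_p=\sup_{0<r<1}\big(\int_{\mathbb T}|f(r\zeta)|^p\,dm(\zeta)\big)^{1/p}<\infty$. For $f(z)=\sum_{\nu\ge 0}a_\nu z^\nu$ in $H^p$ write $s_nf(z)=\sum_{\nu=0}^n a_\nu z^\nu$, and for $f\in L^p(\mathbb T)=L^p(\mathbb T,m)$ write $s_nf(z)=\sum_{\nu=-n}^{n}\hat f(\nu)z^\nu$, where $\hat f(\nu)=\int_{\mathbb T}f(\zeta)\zeta^{-\nu}\,dm(\zeta)$. Let $C(E)$ be the space of continuous functions $E\to\mathbb C$. Then there is a residual (comeagre) set of functions $f$ in $H^p$ such that for every $g\in C(E)$ some subsequence of $(s_nf)_{n\in\Lambda}$ converges to $g$ uniformly on $E$. Likewise, there is a residual set of functions $f$ in $L^p(\mathbb T)$ such that for every $g\in C(E)$ some subsequence of $(s_nf)_{n\in\Lambda}$ converges to $g$ uniformly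 on $E$. -/

import Mathlib

open MeasureTheory Set Filter Topology
open scoped ENNReal

noncomputable section

instance factTwoPiPos : Fact (0 < 2 * Real.pi) := ⟨Real.two_pi_pos⟩

/-- The unit circle, parametrized by `t ↦ exp (i t)`; the corresponding point of the plane is
`(t.toCircle : ℂ)`. -/
abbrev UCircle : Type := AddCircle (2 * Real.pi)

/-- Normalized arc length measure on the unit circle. -/
abbrev arcMeasure : Measure UCircle := AddCircle.haarAddCircle

/-- The dilation `f_r(ζ) = f (r ζ)`, restricted to the unit circle. -/
def dilate (f : ℂ → ℂ) (r : ℝ) (t : UCircle) : ℂ := f (r * (t.toCircle : ℂ))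

/-- The Hardy norm `sup_{0 < r < 1} (∫ |f_r|^p dm)^(1/p)`, with values in `[0, ∞]`. -/
def hardyENorm (p : ℝ≥0∞) (f : ℂ → ℂ) : ℝ≥0∞ :=
  ⨆ r ∈ Ioo (0 : ℝ) 1, eLpNorm (dilate f r) p arcMeasure

lemma mul_toCircle_mem_ball {r : ℝ} (hr : r ∈ Ioo (0 : ℝ) 1) (t : UCircle) :
    (r : ℂ) * (t.toCircle : ℂ) ∈ Metric.ball (0 : ℂ) 1 := by
  rw [mem_ball_zero_iff, norm_mul, Circle.norm_coe, mul_one, Complex.norm_real,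
    Real.norm_of_nonneg hr.1.le]
  exact hr.2

lemma continuous_dilate {f : ℂ → ℂ} (hf : DifferentiableOn ℂ f (Metric.ball 0 1)) {r : ℝ}
    (hr : r ∈ Ioo (0 : ℝ) 1) : Continuous (dilate f r) :=
  hf.continuousOn.comp_continuous
    (continuous_const.mul (continuous_subtype_val.comp AddCircle.continuous_toCircle))
    (mul_toCircle_mem_ball hr)

lemma hardyENorm_add_le {p : ℝ≥0∞} (hp : 1 ≤ p) {f g : ℂ → ℂ}
    (hf : DifferentiableOn ℂ f (Metric.ball 0 1)) (hg : DifferentiableOn ℂ g (Metric.ball 0 1)) :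
    hardyENorm p (f + g) ≤ hardyENorm p f + hardyENorm p g := by
  refine iSup₂_le fun r hr => ?_
  refine (eLpNorm_add_le (f := dilate f r) (g := dilate g r)
    (continuous_dilate hf hr).aestronglyMeasurable
    (continuous_dilate hg hr).aestronglyMeasurable hp).trans ?_
  exact add_le_add (le_iSup₂ (f := fun r (_ : r ∈ Ioo (0 : ℝ) 1) =>
      eLpNorm (dilate f r) p arcMeasure) r hr)
    (le_iSup₂ (f := fun r (_ : r ∈ Ioo (0 : ℝ) 1) => eLpNorm (dilate g r) p arcMeasure) r hr)

lemma hardyENorm_smul (p : ℝ≥0∞) (c : ℂ) (f : ℂ → ℂ) :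
    hardyENorm p (c • f) = ‖c‖ₑ * hardyENorm p f := by
  have h : ∀ r, eLpNorm (dilate (c • f) r) p arcMeasure
      = ‖c‖ₑ * eLpNorm (dilate f r) p arcMeasure := fun r =>
    eLpNorm_const_smul (μ := arcMeasure) c (dilate f r) p
  simp only [hardyENorm, h, ENNReal.mul_iSup]

/-- The functions holomorphic in the open unit disc with finite Hardy norm. A function on the disc
is represented by its extension by zero to the plane, so that equality means equality on the
disc. -/
def hardySubmodule (p : ℝ≥0∞) [hp : Fact (1 ≤ p)] : Submodule ℂ (ℂ → ℂ) where
  carrier := {f | DifferentiableOn ℂ f (Metric.ball 0 1) ∧ (∀ z ∉ Metric.ball (0 : ℂ) 1, f z = 0) ∧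
    hardyENorm p f < ∞}
  zero_mem' := ⟨differentiableOn_const 0, fun _ _ => rfl, by
    have h := hardyENorm_smul p 0 0
    simp only [smul_zero, enorm_zero, zero_mul] at h
    simp [h]⟩
  add_mem' := fun {f g} hf hg => ⟨hf.1.add hg.1, fun z hz => by
    simp [hf.2.1 z hz, hg.2.1 z hz],
    (hardyENorm_add_le hp.out hf.1 hg.1).trans_lt (ENNReal.add_lt_top.2 ⟨hf.2.2, hg.2.2⟩)⟩
  smul_mem' := fun c f hf => ⟨hf.1.const_smul c, fun z hz => by simp [hf.2.1 z hz], by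
    rw [hardyENorm_smul]
    exact ENNReal.mul_lt_top enorm_lt_top hf.2.2⟩

/-- The Hardy space `H^p` of the unit disc. -/
def HardySpace (p : ℝ≥0∞) [Fact (1 ≤ p)] : Type := hardySubmodule p

namespace HardySpace

variable {p : ℝ≥0∞} [hp : Fact (1 ≤ p)]

instance : AddCommGroup (HardySpace p) := inferInstanceAs (AddCommGroup (hardySubmodule p))

instance : Module ℂ (HardySpace p) := inferInstanceAs (Module ℂ (hardySubmodule p))

instance : CoeFun (HardySpace p) (fun _ => ℂ → ℂ) := ⟨fun f => f.1⟩

/-- The Hardy norm. -/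
instance : Norm (HardySpace p) := ⟨fun f => (hardyENorm p f).toReal⟩

lemma eq_zero_of_hardyENorm {f : HardySpace p} (h : hardyENorm p f = 0) : f = 0 := by
  have hp0 : p ≠ 0 := (zero_lt_one.trans_le hp.out).ne'
  have hd : DifferentiableOn ℂ f (Metric.ball 0 1) := f.2.1
  have h1 : ∀ r ∈ Ioo (0 : ℝ) 1, ∀ t, dilate f r t = 0 := by
    intro r hr
    have h2 : eLpNorm (dilate f r) p arcMeasure = 0 :=
      le_antisymm (h ▸ le_iSup₂ (f := fun r (_ : r ∈ Ioo (0 : ℝ) 1) =>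
        eLpNorm (dilate f r) p arcMeasure) r hr) zero_le
    have h3 := (eLpNorm_eq_zero_iff (continuous_dilate hd hr).aestronglyMeasurable hp0).1 h2
    exact congrFun (((continuous_dilate hd hr).ae_eq_iff_eq arcMeasure continuous_const).1 h3)
  have h4 : ∀ z ∈ Metric.ball (0 : ℂ) 1, z ≠ 0 → f.1 z = 0 := by
    intro z hz hz0
    have h5 := h1 ‖z‖ ⟨norm_pos_iff.2 hz0, by simpa using hz⟩ (Complex.arg z : ℝ)
    rw [dilate, AddCircle.toCircle_apply_mk] at h5
    have h6 : (‖z‖ : ℂ) * (Circle.exp (2 * Real.pi / (2 * Real.pi) * Complex.arg z) : ℂ) = z := by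
      rw [div_self (by positivity), one_mul, Circle.coe_exp, Complex.norm_mul_exp_arg_mul_I]
    rwa [h6] at h5
  refine Subtype.ext (funext fun z => ?_)
  by_cases hz : z ∈ Metric.ball (0 : ℂ) 1
  · by_cases hz0 : z = 0
    · subst hz0
      have hc : Tendsto f.1 (𝓝[≠] 0) (𝓝 (f.1 0)) :=
        ((hd.continuousOn.continuousAt (Metric.isOpen_ball.mem_nhds hz)).tendsto).mono_left
          nhdsWithin_le_nhds
      refine tendsto_nhds_unique (hc.congr' ?_) tendsto_const_nhds
      filter_upwards [self_mem_nhdsWithin,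
        mem_nhdsWithin_of_mem_nhds (Metric.isOpen_ball.mem_nhds hz)] with w hw hw1
      exact h4 w hw1 hw
    · exact h4 z hz hz0
  · exact f.2.2.1 z hz

lemma normedSpaceCore : NormedSpace.Core ℂ (HardySpace p) where
  norm_nonneg _ := ENNReal.toReal_nonneg
  norm_smul c f := by
    change (hardyENorm p (c • f.1)).toReal = _
    rw [hardyENorm_smul, ENNReal.toReal_mul, toReal_enorm]
    rfl
  norm_triangle f g := by
    change (hardyENorm p (f.1 + g.1)).toReal ≤ (hardyENorm p f.1).toReal + (hardyENorm p g.1).toReal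
    rw [← ENNReal.toReal_add f.2.2.2.ne g.2.2.2.ne]
    exact ENNReal.toReal_mono (ENNReal.add_ne_top.2 ⟨f.2.2.2.ne, g.2.2.2.ne⟩)
      (hardyENorm_add_le hp.out f.2.1 g.2.1)
  norm_eq_zero_iff f := by
    constructor
    · intro h
      exact eq_zero_of_hardyENorm (((ENNReal.toReal_eq_zero_iff _).1 h).resolve_right f.2.2.2.ne)
    · rintro rfl
      have h := hardyENorm_smul p 0 0
      simp only [smul_zero, enorm_zero, zero_mul] at h
      change (hardyENorm p 0).toReal = 0
      simp [h]

instance : NormedAddCommGroup (HardySpace p) := NormedAddCommGroup.ofCore normedSpaceCore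

instance : NormedSpace ℂ (HardySpace p) := NormedSpace.ofCore normedSpaceCore

end HardySpace

/-- The partial sum `∑_{ν ≤ n} a_ν z^ν` of the Taylor expansion of `f` about `0`. -/
def taylorSum (f : ℂ → ℂ) (n : ℕ) (z : ℂ) : ℂ :=
  ∑ ν ∈ Finset.range (n + 1), iteratedDeriv ν f 0 / (ν.factorial : ℂ) * z ^ ν

/-- The symmetric partial sum `∑_{|ν| ≤ n} f̂(ν) ζ^ν` of the Fourier expansion of `f`. -/
def fourierSum (f : UCircle → ℂ) (n : ℕ) (t : UCircle) : ℂ :=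
  ∑ ν ∈ Finset.Icc (-(n : ℤ)) n, fourierCoeff f ν * (t.toCircle : ℂ) ^ ν

/-- Every `g ∈ C(E)` is the uniform limit on `E` of a subsequence of `(S n)_{n ∈ Λ}`. -/
def HasAllUniformLimits (E : Set UCircle) (Λ : Set ℕ) (S : ℕ → UCircle → ℂ) : Prop :=
  ∀ g : C(E, ℂ), ∃ φ : ℕ → ℕ, StrictMono φ ∧ (∀ k, φ k ∈ Λ) ∧
    TendstoUniformly (fun k (t : E) => S (φ k) t) g atTop

end

/-! The proof is a Baire category argument, `eventually_residual_hasAllUniformLimits`. Since `C(E)`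
is separable, it suffices that, for each member `d` of a dense sequence, each tolerance and each
`m`, the functions `f` for which some `n ∈ Λ`, `n ≥ m`, has `s_n f` within the tolerance of `d` on
`E` form an open dense set. Openness is the continuity of `s_n` into the sup norm. For density,
approximate a given function by a polynomial `q₀` (trigonometric in the case of `L^p`), then add a
polynomial `q` of small norm that is close to `d - q₀` on `E`: the partial sums of `q₀ + q`
eventually equal `q₀ + q`, so any infinite `Λ` will do. Two facts carry this.

Small polynomials with prescribed values on `E` (`exists_polynomial_near_of_null`). As `E` is null,
there is a polynomial `F` with `Re F ≥ 0` on the circle, `Re F` large on `E` and `F(0)` small. Then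
`1 - exp (-F)` is close to `1` on `E`, and its `L²` norm is small because the mean of `exp (-F)` is
`exp (-F(0))`. So the constant `1` is approximable on `E` by polynomials of small norm. The
approximable functions form a closed subspace stable under passing from `z^n` to `z^(n+1)` and to
`z^(n-1)`, hence all of `C(𝕋)`; restriction to `E` is onto `C(E)`.

Density of polynomials in `H^p` (`exists_polynomial_circleNorm_sub_le`), obtained without boundary
values: the dilations `f_r` are Cauchy in `L^p` as `r → 1`. Their norms increase to a supremum `L`.
For `p > 1`, `(f_r + f_s)/2` also has norm near `L`, and uniform convexity forces `f_r - f_s` to be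
small. For `p = 1` uniform convexity fails; it is replaced by `‖f_s - f_r‖₁² ≤ 4 (‖f_s‖₁² -
‖f_r‖₁²)`, proved for polynomials from a factorization `b g²` with `|b| ≤ 1`, which reduces it to
Parseval for `b g` and `g`. -/

noncomputable section

/-! ### Means over the unit circle -/

/-- The `L^p` norm over the unit circle, as a real number. -/
def circleNorm (p : ℝ≥0∞) (u : UCircle → ℂ) : ℝ := (eLpNorm u p arcMeasure).toReal

section circleNorm

variable {p : ℝ≥0∞} {u v : UCircle → ℂ}

lemma memLp_of_continuous (p : ℝ≥0∞) (hu : Continuous u) : MemLp u p arcMeasure :=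
  hu.memLp_of_hasCompactSupport (HasCompactSupport.of_compactSpace u)

lemma integrable_of_continuous {E : Type*} [NormedAddCommGroup E] {u : UCircle → E}
    (hu : Continuous u) : Integrable u arcMeasure :=
  hu.integrable_of_hasCompactSupport (HasCompactSupport.of_compactSpace u)

lemma circleNorm_nonneg : 0 ≤ circleNorm p u := ENNReal.toReal_nonneg

lemma eLpNorm_eq_ofReal_circleNorm (hu : Continuous u) :
    eLpNorm u p arcMeasure = ENNReal.ofReal (circleNorm p u) :=
  (ENNReal.ofReal_toReal (memLp_of_continuous p hu).2.ne).symm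

lemma circleNorm_add_le (hp : 1 ≤ p) (hu : Continuous u) (hv : Continuous v) :
    circleNorm p (u + v) ≤ circleNorm p u + circleNorm p v := by
  rw [circleNorm, circleNorm, circleNorm, ← ENNReal.toReal_add (memLp_of_continuous p hu).2.ne
    (memLp_of_continuous p hv).2.ne]
  exact ENNReal.toReal_mono (ENNReal.add_ne_top.2 ⟨(memLp_of_continuous p hu).2.ne,
    (memLp_of_continuous p hv).2.ne⟩)
    (eLpNorm_add_le hu.aestronglyMeasurable hv.aestronglyMeasurable hp)

lemma circleNorm_neg : circleNorm p (-u) = circleNorm p u := by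
  rw [circleNorm, circleNorm, eLpNorm_neg]

lemma circleNorm_sub_comm : circleNorm p (u - v) = circleNorm p (v - u) := by
  rw [← neg_sub, circleNorm_neg]

lemma circleNorm_sub_le (hp : 1 ≤ p) (hu : Continuous u) (hv : Continuous v) :
    circleNorm p (u - v) ≤ circleNorm p u + circleNorm p v := by
  rw [sub_eq_add_neg]
  exact (circleNorm_add_le hp hu hv.neg).trans_eq (by rw [circleNorm_neg])

lemma circleNorm_const_smul (c : ℂ) : circleNorm p (c • u) = ‖c‖ * circleNorm p u := by
  rw [circleNorm, circleNorm, eLpNorm_const_smul, ENNReal.toReal_mul, toReal_enorm]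

lemma circleNorm_le_of_bound {C : ℝ} (hC : 0 ≤ C) (h : ∀ t, ‖u t‖ ≤ C) : circleNorm p u ≤ C := by
  have := eLpNorm_le_of_ae_bound (p := p) (μ := arcMeasure) (Eventually.of_forall h)
  rw [measure_univ, ENNReal.one_rpow, one_mul] at this
  exact ENNReal.toReal_le_of_le_ofReal hC this

lemma circleNorm_mono (hv : Continuous v) (h : ∀ t, ‖u t‖ ≤ ‖v t‖) :
    circleNorm p u ≤ circleNorm p v :=
  ENNReal.toReal_mono (memLp_of_continuous p hv).2.ne (eLpNorm_mono h)

lemma circleNorm_rpow (hp : 1 ≤ p) (hp' : p ≠ ∞) (hu : Continuous u) :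
    circleNorm p u ^ p.toReal = ∫ t, ‖u t‖ ^ p.toReal ∂arcMeasure := by
  have h0 : p ≠ 0 := (zero_lt_one.trans_le hp).ne'
  have hI : 0 ≤ ∫ t, ‖u t‖ ^ p.toReal ∂arcMeasure := integral_nonneg fun t => by positivity
  rw [circleNorm, (memLp_of_continuous p hu).eLpNorm_eq_integral_rpow_norm h0 hp',
    ENNReal.toReal_ofReal (by positivity), ← Real.rpow_mul hI,
    inv_mul_cancel₀ (ENNReal.toReal_pos h0 hp').ne', Real.rpow_one]

lemma circleNorm_one (hu : Continuous u) : circleNorm 1 u = ∫ t, ‖u t‖ ∂arcMeasure := by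
  simpa using circleNorm_rpow le_rfl ENNReal.one_ne_top hu

lemma circleNorm_two_sq (hu : Continuous u) :
    circleNorm 2 u ^ 2 = ∫ t, ‖u t‖ ^ 2 ∂arcMeasure := by
  simpa using circleNorm_rpow one_le_two ENNReal.ofNat_ne_top hu

lemma circleNorm_mono_exponent {q : ℝ≥0∞} (hpq : p ≤ q) (hu : Continuous u) :
    circleNorm p u ≤ circleNorm q u :=
  ENNReal.toReal_mono (memLp_of_continuous q hu).2.ne
    (eLpNorm_le_eLpNorm_of_exponent_le hpq hu.aestronglyMeasurable)

lemma circleNorm_one_mul_le (hu : Continuous u) (hv : Continuous v) :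
    circleNorm 1 (u * v) ≤ circleNorm 2 u * circleNorm 2 v := by
  rw [circleNorm, circleNorm, circleNorm, ← ENNReal.toReal_mul]
  refine ENNReal.toReal_mono (ENNReal.mul_ne_top (memLp_of_continuous 2 hu).2.ne
    (memLp_of_continuous 2 hv).2.ne) ?_
  have := eLpNorm_smul_le_mul_eLpNorm (p := 2) (q := 2) (r := 1) (μ := arcMeasure)
    hv.aestronglyMeasurable hu.aestronglyMeasurable
  simpa using this

lemma circleNorm_comp_add_left (s : UCircle) (hu : Continuous u) :
    circleNorm p (fun t => u (s + t)) = circleNorm p u := by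
  rw [circleNorm, circleNorm]
  congr 1
  exact eLpNorm_comp_measurePreserving hu.aestronglyMeasurable
    (measurePreserving_add_left arcMeasure s)

end circleNorm

/-! ### Dilations -/

@[fun_prop]
lemma continuous_coe_toCircle : Continuous fun t : UCircle => (t.toCircle : ℂ) :=
  continuous_subtype_val.comp AddCircle.continuous_toCircle

lemma norm_mul_toCircle {r : ℝ} (hr : 0 ≤ r) (t : UCircle) :
    ‖(r : ℂ) * (t.toCircle : ℂ)‖ = r := by
  rw [norm_mul, Circle.norm_coe, mul_one, Complex.norm_real, Real.norm_of_nonneg hr]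

lemma continuous_dilate_of_lt {f : ℂ → ℂ} {R r : ℝ} (hf : DifferentiableOn ℂ f (Metric.ball 0 R))
    (hr0 : 0 ≤ r) (hr : r < R) : Continuous (dilate f r) :=
  hf.continuousOn.comp_continuous (by fun_prop)
    fun t => by rw [mem_ball_zero_iff, norm_mul_toCircle hr0]; exact hr

@[fun_prop]
lemma continuous_dilate_eval (q : Polynomial ℂ) (r : ℝ) :
    Continuous (dilate (fun z => q.eval z) r) :=
  q.continuous.comp (by fun_prop)

lemma circleAverage_eq_integral {E : Type*} [NormedAddCommGroup E] [NormedSpace ℝ E] (f : ℂ → E)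
    (r : ℝ) : Real.circleAverage f 0 r = ∫ t : UCircle, f (r * (t.toCircle : ℂ)) ∂arcMeasure := by
  rw [AddCircle.integral_haarAddCircle, Real.circleAverage,
    ← AddCircle.intervalIntegral_preimage (2 * Real.pi) 0, zero_add]
  congr 2
  ext θ
  rw [AddCircle.toCircle_apply_mk, div_self (by positivity), one_mul, Circle.coe_exp, circleMap,
    zero_add]

lemma integral_dilate {f : ℂ → ℂ} {R r : ℝ} (hf : DifferentiableOn ℂ f (Metric.ball 0 R))
    (hr0 : 0 ≤ r) (hr : r < R) : ∫ t, dilate f r t ∂arcMeasure = f 0 := by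
  have h : DiffContOnCl ℂ f (Metric.ball 0 |r|) := by
    refine (hf.mono ?_).diffContOnCl
    rw [abs_of_nonneg hr0]
    exact Metric.closure_ball_subset_closedBall.trans (Metric.closedBall_subset_ball hr)
  rw [← h.circleAverage, circleAverage_eq_integral]
  rfl

lemma exists_polynomial_near {f : ℂ → ℂ} {R r : ℝ} (hf : DifferentiableOn ℂ f (Metric.ball 0 R))
    (hr0 : 0 ≤ r) (hr : r < R) {ε : ℝ} (hε : 0 < ε) :
    ∃ q : Polynomial ℂ, ∀ z : ℂ, ‖z‖ ≤ r → ‖f z - q.eval z‖ < ε := by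
  -- Two spare radii: the Cauchy series is taken on the disc of radius `a`, and it converges
  -- uniformly on the smaller open disc of radius `b`, which contains the closed disc of radius `r`.
  obtain ⟨a, hra, haR⟩ := exists_between hr
  obtain ⟨b, hrb, hba⟩ := exists_between hra
  lift a to NNReal using hr0.trans hra.le
  lift b to NNReal using hr0.trans hrb.le
  have ha0 : 0 < a := lt_of_le_of_lt (show (0 : NNReal) ≤ b from zero_le) (by exact_mod_cast hba)
  have hs := (hf.mono (Metric.closedBall_subset_ball haR)).hasFPowerSeriesOnBall ha0
  have hu := Metric.tendstoUniformlyOn_iff.1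
    (hs.tendstoUniformlyOn (r' := b) (by exact_mod_cast hba)) ε hε
  obtain ⟨n, hn⟩ := hu.exists
  refine ⟨∑ k ∈ Finset.range n, Polynomial.monomial k ((cauchyPowerSeries f 0 a).coeff k),
    fun z hz => ?_⟩
  have := hn z (by rw [mem_ball_zero_iff]; exact hz.trans_lt hrb)
  rw [dist_eq_norm, zero_add] at this
  refine lt_of_eq_of_lt (congrArg (fun x => ‖f z - x‖) ?_) this
  rw [Polynomial.eval_finsetSum]
  change _ = ∑ k ∈ Finset.range n, cauchyPowerSeries f 0 a k fun _ => z
  refine Finset.sum_congr rfl fun k _ => ?_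
  rw [Polynomial.eval_monomial, FormalMultilinearSeries.apply_eq_pow_smul_coeff, smul_eq_mul,
    mul_comm]

/-- The circle values of `z ↦ q (w z)`. -/
def rotated (q : Polynomial ℂ) (w : ℂ) : C(UCircle, ℂ) :=
  ∑ k ∈ Finset.range (q.natDegree + 1), (q.coeff k * w ^ k) • fourier (k : ℤ)

lemma rotated_apply (q : Polynomial ℂ) (w : ℂ) (t : UCircle) :
    rotated q w t = q.eval (w * t.toCircle) := by
  rw [rotated, Polynomial.eval_eq_sum_range]
  simp only [ContinuousMap.coe_sum, ContinuousMap.coe_smul, Finset.sum_apply, Pi.smul_apply,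
    fourier_apply, smul_eq_mul, mul_pow, natCast_zsmul, AddCircle.toCircle_nsmul,
    Circle.coe_pow, mul_assoc]

/-- This is the maximum principle for the `L^p`-valued holomorphic map `w ↦ q(w ·)`: by rotation
invariance of the measure, its norm depends only on `|w|`. -/
lemma circleNorm_dilate_eval_mono {p : ℝ≥0∞} [Fact (1 ≤ p)] (q : Polynomial ℂ) {r s : ℝ}
    (hr : 0 ≤ r) (hrs : r ≤ s) :
    circleNorm p (dilate (fun z => q.eval z) r) ≤ circleNorm p (dilate (fun z => q.eval z) s) := by
  have hN : ∀ w : ℂ, ‖ContinuousMap.toLp p arcMeasure ℂ (rotated q w)‖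
      = circleNorm p (fun t => q.eval (w * t.toCircle)) := by
    intro w
    rw [Lp.norm_def, circleNorm, eLpNorm_congr_ae (ContinuousMap.coeFn_toLp arcMeasure _)]
    congr 2
    exact funext (rotated_apply q w)
  rcases hrs.eq_or_lt with rfl | hlt
  · rfl
  have hs : 0 < s := hr.trans_lt hlt
  have hd : Differentiable ℂ fun w => ContinuousMap.toLp p arcMeasure ℂ (rotated q w) := by
    have : Differentiable ℂ fun w => rotated q w := by
      unfold rotated
      fun_prop
    exact (ContinuousMap.toLp p arcMeasure ℂ).differentiable.comp this
  have hmax := Complex.norm_le_of_forall_mem_frontier_norm_le (U := Metric.ball (0 : ℂ) s)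
    Metric.isBounded_ball hd.diffContOnCl
    (C := circleNorm p (dilate (fun z => q.eval z) s)) ?_ (z := (r : ℂ)) ?_
  · rw [hN] at hmax
    exact hmax
  · intro w hw
    rw [frontier_ball _ hs.ne', mem_sphere_zero_iff_norm] at hw
    have hw' : w = s * (AddCircle.toCircle ((w.arg : ℝ) : UCircle) : ℂ) := by
      rw [AddCircle.toCircle_apply_mk, div_self (by positivity), one_mul, Circle.coe_exp, ← hw,
        Complex.norm_mul_exp_arg_mul_I]
    rw [hN, ← circleNorm_comp_add_left (u := dilate (fun z => q.eval z) s)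
      ((w.arg : ℝ) : UCircle) (continuous_dilate_eval q s)]
    refine le_of_eq ?_
    congr 1
    funext t
    rw [dilate, AddCircle.toCircle_add, Circle.coe_mul, ← mul_assoc, ← hw']
  · refine subset_closure ?_
    rw [mem_ball_zero_iff, Complex.norm_real, Real.norm_of_nonneg hr]
    exact hlt

lemma circleNorm_dilate_mono {p : ℝ≥0∞} [hp : Fact (1 ≤ p)] {f : ℂ → ℂ} {R r s : ℝ}
    (hf : DifferentiableOn ℂ f (Metric.ball 0 R)) (hr : 0 ≤ r) (hrs : r ≤ s) (hs : s < R) :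
    circleNorm p (dilate f r) ≤ circleNorm p (dilate f s) := by
  refine le_of_forall_pos_le_add fun ε hε => ?_
  obtain ⟨q, hq⟩ := exists_polynomial_near hf (hr.trans hrs) hs (half_pos hε)
  have hclose : ∀ x, 0 ≤ x → x ≤ s →
      circleNorm p (dilate f x - dilate (fun z => q.eval z) x) ≤ ε / 2 := fun x hx hxs =>
    circleNorm_le_of_bound (half_pos hε).le fun t =>
      (hq _ (by rw [norm_mul_toCircle hx]; exact hxs)).le
  have hcf : ∀ x, 0 ≤ x → x ≤ s → Continuous (dilate f x) := fun x hx hxs =>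
    continuous_dilate_of_lt hf hx (hxs.trans_lt hs)
  have h1 := circleNorm_add_le hp.out ((hcf r hr hrs).sub (continuous_dilate_eval q r))
    (continuous_dilate_eval q r)
  have h2 := circleNorm_add_le hp.out
    ((continuous_dilate_eval q s).sub (hcf s (hr.trans hrs) le_rfl)) (hcf s (hr.trans hrs) le_rfl)
  rw [sub_add_cancel] at h1 h2
  have h3 := hclose s (hr.trans hrs) le_rfl
  rw [circleNorm_sub_comm] at h3
  linarith [hclose r hr hrs, circleNorm_dilate_eval_mono (p := p) q hr hrs]

/-! ### A quantitative convergence estimate in `H¹` -/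

lemma tendsto_circleNorm_of_uniform {ι : Type*} {l : Filter ι} {p : ℝ≥0∞} (hp : 1 ≤ p)
    {u : ι → UCircle → ℂ} {v : UCircle → ℂ} (hu : ∀ i, Continuous (u i)) (hv : Continuous v)
    {ε : ι → ℝ} (hε : Tendsto ε l (𝓝 0)) (h : ∀ i t, ‖u i t - v t‖ ≤ ε i) :
    Tendsto (fun i => circleNorm p (u i)) l (𝓝 (circleNorm p v)) := by
  rw [tendsto_iff_dist_tendsto_zero]
  refine squeeze_zero (fun _ => dist_nonneg) (fun i => ?_) hε
  have h0 : 0 ≤ ε i := (norm_nonneg _).trans (h i 0)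
  have h1 : circleNorm p (u i - v) ≤ ε i := circleNorm_le_of_bound h0 (h i)
  have h2 := circleNorm_add_le hp ((hu i).sub hv) hv
  have h3 := circleNorm_add_le hp (hv.sub (hu i)) (hu i)
  rw [sub_add_cancel] at h2 h3
  rw [circleNorm_sub_comm] at h3
  rw [Real.dist_eq, abs_le]
  constructor <;> linarith

/-- A holomorphic function is a uniform limit of polynomials on compact discs, in a form
suited to passing to the limit in norm inequalities. -/
lemma exists_polynomial_seq {f : ℂ → ℂ} {R s : ℝ} (hf : DifferentiableOn ℂ f (Metric.ball 0 R))
    (hs0 : 0 ≤ s) (hs : s < R) : ∃ q : ℕ → Polynomial ℂ, ∀ p : ℝ≥0∞, 1 ≤ p →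
      (∀ x, 0 ≤ x → x ≤ s → Tendsto (fun n => circleNorm p (dilate (fun z => (q n).eval z) x)) atTop
        (𝓝 (circleNorm p (dilate f x)))) ∧
      ∀ x y, 0 ≤ x → x ≤ s → 0 ≤ y → y ≤ s →
        Tendsto (fun n => circleNorm p
          (dilate (fun z => (q n).eval z) x - dilate (fun z => (q n).eval z) y)) atTop
        (𝓝 (circleNorm p (dilate f x - dilate f y))) := by
  choose q hq using fun n : ℕ => exists_polynomial_near hf hs0 hs (Nat.one_div_pos_of_nat (n := n))
  have hc : ∀ x, 0 ≤ x → x ≤ s → Continuous (dilate f x) := fun x hx hxs =>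
    continuous_dilate_of_lt hf hx (hxs.trans_lt hs)
  have hb : ∀ x, 0 ≤ x → x ≤ s → ∀ n t,
      ‖dilate (fun z => (q n).eval z) x t - dilate f x t‖ ≤ 1 / ((n : ℝ) + 1) := by
    intro x hx hxs n t
    rw [norm_sub_rev]
    exact (hq n _ (by rw [norm_mul_toCircle hx]; exact hxs)).le
  refine ⟨q, fun p hp => ⟨fun x hx hxs => ?_, fun x y hx hxs hy hys => ?_⟩⟩
  · exact tendsto_circleNorm_of_uniform hp (fun n => continuous_dilate_eval _ _) (hc x hx hxs)
      tendsto_one_div_add_atTop_nhds_zero_nat (hb x hx hxs)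
  · refine tendsto_circleNorm_of_uniform hp
      (fun n => (continuous_dilate_eval _ _).sub (continuous_dilate_eval _ _))
      ((hc x hx hxs).sub (hc y hy hys))
      (ε := fun n : ℕ => 1 / ((n : ℝ) + 1) + 1 / ((n : ℝ) + 1)) ?_ fun n t => ?_
    · simpa using (tendsto_one_div_add_atTop_nhds_zero_nat (𝕜 := ℝ)).add
        (tendsto_one_div_add_atTop_nhds_zero_nat (𝕜 := ℝ))
    · rw [Pi.sub_apply, Pi.sub_apply, sub_sub_sub_comm]
      exact (norm_sub_le _ _).trans (add_le_add (hb x hx hxs n t) (hb y hy hys n t))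

/-! ### Increments of dilations in `L²`, by Parseval. -/

lemma circleNorm_two_sq_sum (n : ℕ) (c : ℕ → ℂ) :
    circleNorm 2 (fun t => ∑ k ∈ Finset.range n, c k * (t.toCircle : ℂ) ^ k) ^ 2
      = ∑ k ∈ Finset.range n, ‖c k‖ ^ 2 := by
  set P : Polynomial ℂ := ∑ k ∈ Finset.range n, Polynomial.monomial k (c k) with hP
  have hev : ∀ z, P.eval z = ∑ k ∈ Finset.range n, c k * z ^ k := fun z => by
    simp [hP, Polynomial.eval_finsetSum]
  have hco : ∀ k, P.coeff k = if k < n then c k else 0 := fun k => by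
    simp [hP, Polynomial.finsetSum_coeff, Polynomial.coeff_monomial]
  have h := P.sum_sq_norm_coeff_eq_circleAverage
  rw [circleAverage_eq_integral] at h
  simp only [Complex.ofReal_one, one_mul, hev] at h
  rw [circleNorm_two_sq (by fun_prop), ← h]
  refine (Finset.sum_subset (f := fun k => ‖P.coeff k‖ ^ 2) (s₁ := P.support)
    (s₂ := Finset.range n) (fun k hk => ?_) fun k _ hk => ?_).trans
    (Finset.sum_congr rfl fun k hk => ?_)
  · by_contra hkn
    rw [Finset.mem_range] at hkn
    simp [hco, hkn] at hk
  · rw [Polynomial.mem_support_iff, not_not] at hk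
    simp [hk]
  · rw [hco, if_pos (Finset.mem_range.1 hk)]

/-- By Parseval this holds coefficient by coefficient: `(s^k - r^k)² + (r^k)² ≤ (s^k)²`, since both
`s^k - r^k` and `r^k` are nonnegative. -/
lemma circleNorm_two_dilate_sub_eval (q : Polynomial ℂ) {r s : ℝ} (hr : 0 ≤ r) (hrs : r ≤ s) :
    circleNorm 2 (dilate (fun z => q.eval z) s - dilate (fun z => q.eval z) r) ^ 2
      + circleNorm 2 (dilate (fun z => q.eval z) r) ^ 2
      ≤ circleNorm 2 (dilate (fun z => q.eval z) s) ^ 2 := by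
  have hx : ∀ x : ℝ, dilate (fun z => q.eval z) x = fun t =>
      ∑ k ∈ Finset.range (q.natDegree + 1), (q.coeff k * (x : ℂ) ^ k) * (t.toCircle : ℂ) ^ k := by
    intro x
    funext t
    rw [dilate, Polynomial.eval_eq_sum_range]
    exact Finset.sum_congr rfl fun k _ => by rw [mul_pow, mul_assoc]
  have hsub : dilate (fun z => q.eval z) s - dilate (fun z => q.eval z) r = fun t =>
      ∑ k ∈ Finset.range (q.natDegree + 1),
        (q.coeff k * ((s : ℂ) ^ k - (r : ℂ) ^ k)) * (t.toCircle : ℂ) ^ k := by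
    rw [hx, hx]
    funext t
    rw [Pi.sub_apply, ← Finset.sum_sub_distrib]
    exact Finset.sum_congr rfl fun k _ => by ring
  rw [hsub, hx, hx, circleNorm_two_sq_sum, circleNorm_two_sq_sum, circleNorm_two_sq_sum,
    ← Finset.sum_add_distrib]
  refine Finset.sum_le_sum fun k _ => ?_
  have h1 : r ^ k ≤ s ^ k := pow_le_pow_left₀ hr hrs k
  have h2 : 0 ≤ r ^ k := pow_nonneg hr k
  have h3 : ‖(s : ℂ) ^ k - (r : ℂ) ^ k‖ = s ^ k - r ^ k := by
    rw [← Complex.ofReal_pow, ← Complex.ofReal_pow, ← Complex.ofReal_sub, Complex.norm_real,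
      Real.norm_of_nonneg (sub_nonneg.2 h1)]
  have h4 : ∀ x : ℝ, 0 ≤ x → ‖(x : ℂ) ^ k‖ = x ^ k := fun x hx => by
    rw [norm_pow, Complex.norm_real, Real.norm_of_nonneg hx]
  rw [norm_mul, norm_mul, norm_mul, h3, h4 r hr, h4 s (hr.trans hrs), mul_pow, mul_pow, mul_pow,
    ← mul_add]
  refine mul_le_mul_of_nonneg_left ?_ (by positivity)
  nlinarith

lemma circleNorm_two_dilate_sub {f : ℂ → ℂ} {R r s : ℝ}
    (hf : DifferentiableOn ℂ f (Metric.ball 0 R)) (hr : 0 ≤ r) (hrs : r ≤ s) (hs : s < R) :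
    circleNorm 2 (dilate f s - dilate f r) ^ 2 + circleNorm 2 (dilate f r) ^ 2
      ≤ circleNorm 2 (dilate f s) ^ 2 := by
  obtain ⟨q, hq⟩ := exists_polynomial_seq hf (hr.trans hrs) hs
  obtain ⟨h1, h2⟩ := hq 2 one_le_two
  exact le_of_tendsto_of_tendsto' (((h2 s r (hr.trans hrs) le_rfl hr hrs).pow 2).add
    ((h1 r hr hrs).pow 2)) ((h1 s (hr.trans hrs) le_rfl).pow 2)
    fun n => circleNorm_two_dilate_sub_eval (q n) hr hrs

lemma dilate_mul (f g : ℂ → ℂ) (r : ℝ) : dilate (f * g) r = dilate f r * dilate g r := rfl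

/-- The estimate for a product `b g²` with `|b| ≤ 1`. -/
lemma circleNorm_one_dilate_mul_sub {b g : ℂ → ℂ} {R r s : ℝ}
    (hb : DifferentiableOn ℂ b (Metric.ball 0 R)) (hg : DifferentiableOn ℂ g (Metric.ball 0 R))
    (hb1 : ∀ z ∈ Metric.ball (0 : ℂ) R, ‖b z‖ ≤ 1) (hr : 0 ≤ r) (hrs : r ≤ s) (hs : s < R) :
    circleNorm 1 (dilate (b * g * g) s - dilate (b * g * g) r) ^ 2 ≤
      4 * (circleNorm 1 (dilate (g * g) s) ^ 2 - circleNorm 1 (dilate (b * g * g) r) ^ 2) := by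
  have hh : DifferentiableOn ℂ (b * g) (Metric.ball 0 R) := hb.mul hg
  have hs0 := hr.trans hrs
  have hrR := hrs.trans_lt hs
  have cgs := continuous_dilate_of_lt hg hs0 hs
  have cgr := continuous_dilate_of_lt hg hr hrR
  have chs := continuous_dilate_of_lt hh hs0 hs
  have chr' := continuous_dilate_of_lt hh hr hrR
  have hA : circleNorm 1 (dilate (g * g) s) = circleNorm 2 (dilate g s) ^ 2 := by
    rw [dilate_mul, circleNorm_one (cgs.mul cgs), circleNorm_two_sq cgs]
    exact integral_congr_ae (Eventually.of_forall fun t => by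
      simp only [Pi.mul_apply, norm_mul, sq])
  have hD : circleNorm 1 (dilate (b * g * g) r)
      ≤ circleNorm 2 (dilate (b * g) r) * circleNorm 2 (dilate g r) := by
    rw [dilate_mul]
    exact circleNorm_one_mul_le chr' cgr
  have hE : circleNorm 1 (dilate (b * g * g) s - dilate (b * g * g) r)
      ≤ circleNorm 2 (dilate (b * g) s - dilate (b * g) r) * circleNorm 2 (dilate g s)
        + circleNorm 2 (dilate (b * g) r) * circleNorm 2 (dilate g s - dilate g r) := by
    -- The product is telescoped so that each term contains one increment, of `b g` or of `g`;
    -- Cauchy–Schwarz then leaves only `L²` norms.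
    have : dilate (b * g * g) s - dilate (b * g * g) r
        = (dilate (b * g) s - dilate (b * g) r) * dilate g s
          + dilate (b * g) r * (dilate g s - dilate g r) := by
      rw [dilate_mul (b * g) g, dilate_mul (b * g) g]
      ring
    rw [this]
    exact (circleNorm_add_le le_rfl ((chs.sub chr').mul cgs) (chr'.mul (cgs.sub cgr))).trans
      (add_le_add (circleNorm_one_mul_le (chs.sub chr') cgs)
        (circleNorm_one_mul_le chr' (cgs.sub cgr)))
  have hXx : circleNorm 2 (dilate (b * g) s) ≤ circleNorm 2 (dilate g s) := by
    refine circleNorm_mono cgs fun t => ?_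
    rw [dilate_mul, Pi.mul_apply, norm_mul]
    exact mul_le_of_le_one_left (norm_nonneg _) (hb1 _ (by
      rw [mem_ball_zero_iff, norm_mul_toCircle hs0]; exact hs))
  have h2 : (1 : ℝ≥0∞) ≤ 2 := one_le_two
  have : Fact ((1 : ℝ≥0∞) ≤ 2) := ⟨h2⟩
  have hYX := circleNorm_dilate_mono (p := 2) hh hr hrs hs
  have hyx := circleNorm_dilate_mono (p := 2) hg hr hrs hs
  have ha := circleNorm_two_dilate_sub hh hr hrs hs
  have hbb := circleNorm_two_dilate_sub hg hr hrs hs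
  have p1 := circleNorm_nonneg (p := 2) (u := dilate g s)
  have p2 := circleNorm_nonneg (p := 2) (u := dilate g r)
  have p3 := circleNorm_nonneg (p := 2) (u := dilate (b * g) s)
  have p4 := circleNorm_nonneg (p := 2) (u := dilate (b * g) r)
  have p5 := circleNorm_nonneg (p := 2) (u := dilate (b * g) s - dilate (b * g) r)
  have p6 := circleNorm_nonneg (p := 2) (u := dilate g s - dilate g r)
  have p7 := circleNorm_nonneg (p := 1) (u := dilate (b * g * g) r)
  have p8 := circleNorm_nonneg (p := 1) (u := dilate (b * g * g) s - dilate (b * g * g) r)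
  rw [hA]
  generalize circleNorm 1 (dilate (b * g * g) s - dilate (b * g * g) r) = E at *
  generalize circleNorm 1 (dilate (b * g * g) r) = D at *
  generalize circleNorm 2 (dilate (b * g) s - dilate (b * g) r) = α at *
  generalize circleNorm 2 (dilate g s - dilate g r) = β at *
  generalize circleNorm 2 (dilate g s) = x at *
  generalize circleNorm 2 (dilate g r) = y at *
  generalize circleNorm 2 (dilate (b * g) s) = X at *
  generalize circleNorm 2 (dilate (b * g) r) = Y at *
  have hX2 : X ^ 2 ≤ x ^ 2 := pow_le_pow_left₀ p3 hXx 2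
  have hY2 : Y ^ 2 ≤ x ^ 2 := pow_le_pow_left₀ p4 (hYX.trans hXx) 2
  have hy2 : y ^ 2 ≤ x ^ 2 := pow_le_pow_left₀ p2 hyx 2
  have hD2 : D ^ 2 ≤ Y ^ 2 * y ^ 2 := by
    rw [← mul_pow]
    exact pow_le_pow_left₀ p7 hD 2
  -- Each of the two products, squared, is bounded by the same difference. Here `|b| ≤ 1` enters
  -- through `X ≤ x`, and Cauchy–Schwarz at radius `r` through `D ≤ Y y`.
  have e1 : α ^ 2 * x ^ 2 ≤ (x ^ 2) ^ 2 - D ^ 2 := by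
    have := mul_le_mul_of_nonneg_right (show α ^ 2 ≤ x ^ 2 - Y ^ 2 by linarith) (sq_nonneg x)
    have := mul_le_mul_of_nonneg_left hy2 (sq_nonneg Y)
    nlinarith
  have e2 : Y ^ 2 * β ^ 2 ≤ (x ^ 2) ^ 2 - D ^ 2 := by
    have := mul_le_mul hY2 (show β ^ 2 ≤ x ^ 2 - y ^ 2 by linarith) (sq_nonneg _) (sq_nonneg _)
    have := mul_le_mul_of_nonneg_right hY2 (sq_nonneg y)
    nlinarith
  have e3 : E ^ 2 ≤ (α * x + Y * β) ^ 2 := pow_le_pow_left₀ p8 hE 2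
  -- The constant 4 comes from `(A + B)² ≤ 2 (A² + B²)` applied to the two products.
  nlinarith [sq_nonneg (α * x - Y * β)]

/-! ### Factorization of polynomials in the disc, and the `L¹` estimate. -/

/-- `q = b g²` in the unit disc with `|b| ≤ 1`, where `g²` is a polynomial of the same modulus as
`q` on the unit circle. -/
def HasInnerOuterFactorization (q : Polynomial ℂ) : Prop :=
  ∃ (F : Polynomial ℂ) (b g : ℂ → ℂ), DifferentiableOn ℂ b (Metric.ball 0 1) ∧
    DifferentiableOn ℂ g (Metric.ball 0 1) ∧
    (∀ z ∈ Metric.ball (0 : ℂ) 1, q.eval z = b z * g z * g z ∧ g z * g z = F.eval z ∧ ‖b z‖ ≤ 1) ∧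
    ∀ z : ℂ, ‖z‖ = 1 → ‖F.eval z‖ = ‖q.eval z‖

lemma HasInnerOuterFactorization.mul {p q : Polynomial ℂ} (hp : HasInnerOuterFactorization p)
    (hq : HasInnerOuterFactorization q) : HasInnerOuterFactorization (p * q) := by
  obtain ⟨F, b, g, hb, hg, h, h'⟩ := hp
  obtain ⟨G, c, k, hc, hk, l, l'⟩ := hq
  refine ⟨F * G, b * c, g * k, hb.mul hc, hg.mul hk, fun z hz => ?_, fun z hz => ?_⟩
  · obtain ⟨h1, h2, h3⟩ := h z hz
    obtain ⟨l1, l2, l3⟩ := l z hz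
    refine ⟨?_, ?_, ?_⟩
    · rw [Polynomial.eval_mul, h1, l1]
      simp only [Pi.mul_apply]
      ring
    · rw [Polynomial.eval_mul, ← h2, ← l2]
      simp only [Pi.mul_apply]
      ring
    · rw [Pi.mul_apply, norm_mul]
      exact mul_le_one₀ h3 (norm_nonneg _) l3
  · rw [Polynomial.eval_mul, Polynomial.eval_mul, norm_mul, norm_mul, h' z hz, l' z hz]

lemma hasInnerOuterFactorization_C (c : ℂ) : HasInnerOuterFactorization (Polynomial.C c) := by
  obtain ⟨d, hd⟩ := IsAlgClosed.exists_pow_nat_eq c two_pos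
  refine ⟨Polynomial.C c, 1, fun _ => d, differentiableOn_const 1, differentiableOn_const d,
    fun z _ => ?_, fun z _ => rfl⟩
  simp [← hd, sq]

lemma re_one_sub_mul_pos {a z : ℂ} (ha : ‖a‖ ≤ 1) (hz : ‖z‖ < 1) : 0 < (1 - a * z).re := by
  have h : ‖a * z‖ < 1 := by
    rw [norm_mul]
    exact (mul_le_of_le_one_left (norm_nonneg _) ha).trans_lt hz
  rw [Complex.sub_re, Complex.one_re]
  linarith [(Complex.re_le_norm (a * z))]

/-- A square root of `1 - a z` in the unit disc. -/
lemma exists_sqrt_one_sub_mul {a : ℂ} (ha : ‖a‖ ≤ 1) : ∃ g : ℂ → ℂ,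
    DifferentiableOn ℂ g (Metric.ball 0 1) ∧ ∀ z ∈ Metric.ball (0 : ℂ) 1, g z * g z = 1 - a * z := by
  refine ⟨fun z => (1 - a * z) ^ (1 / 2 : ℂ), ?_, fun z hz => ?_⟩
  · refine DifferentiableOn.cpow_const (by fun_prop) fun z hz => ?_
    rw [mem_ball_zero_iff] at hz
    exact Or.inl (re_one_sub_mul_pos ha hz)
  · rw [mem_ball_zero_iff] at hz
    have h0 : 1 - a * z ≠ 0 := fun h => by
      have := re_one_sub_mul_pos ha hz
      rw [h, Complex.zero_re] at this
      exact lt_irrefl _ this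
    change (1 - a * z) ^ (1 / 2 : ℂ) * (1 - a * z) ^ (1 / 2 : ℂ) = _
    rw [← Complex.cpow_add _ _ h0]
    norm_num

/-- This identity shows that the Blaschke factor `(z - a)/(1 - ā z)` is bounded by `1` in the disc,
and that numerator and denominator have equal modulus on the circle. -/
lemma normSq_one_sub_conj_mul (a z : ℂ) :
    ‖1 - (starRingEnd ℂ) a * z‖ ^ 2 - ‖z - a‖ ^ 2 = (1 - ‖a‖ ^ 2) * (1 - ‖z‖ ^ 2) := by
  simp only [← Complex.normSq_eq_norm_sq, Complex.normSq_apply, Complex.sub_re, Complex.sub_im,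
    Complex.mul_re, Complex.mul_im, Complex.conj_re, Complex.conj_im, Complex.one_re, Complex.one_im]
  ring

/-- If `|a| ≥ 1` there is no zero in the open disc, so `b = 1` works, with the square root of `1 -
a⁻¹ z`. If `|a| < 1` the zero is moved into a Blaschke factor, leaving `1 - ā z`, which has a square
root. -/
lemma hasInnerOuterFactorization_X_sub_C (a : ℂ) :
    HasInnerOuterFactorization (Polynomial.X - Polynomial.C a) := by
  rcases le_or_gt 1 ‖a‖ with ha | ha
  · have ha0 : a ≠ 0 := norm_pos_iff.1 (zero_lt_one.trans_le ha)
    have h : Polynomial.X - Polynomial.C a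
        = Polynomial.C (-a) * (1 - Polynomial.C a⁻¹ * Polynomial.X) := by
      rw [mul_sub, mul_one, ← mul_assoc, ← Polynomial.C_mul, neg_mul, mul_inv_cancel₀ ha0]
      simp only [map_neg, Polynomial.C_1]
      ring
    rw [h]
    obtain ⟨g, hg, hg'⟩ := exists_sqrt_one_sub_mul (a := a⁻¹)
      (by rw [norm_inv]; exact inv_le_one_of_one_le₀ ha)
    refine (hasInnerOuterFactorization_C _).mul
      ⟨_, 1, g, differentiableOn_const 1, hg, fun z hz => ?_, fun z _ => rfl⟩
    simp [hg' z hz]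
  · have hc : ‖(starRingEnd ℂ) a‖ ≤ 1 := by rw [RCLike.norm_conj]; exact ha.le
    obtain ⟨g, hg, hg'⟩ := exists_sqrt_one_sub_mul hc
    have hne : ∀ z ∈ Metric.ball (0 : ℂ) 1, 1 - (starRingEnd ℂ) a * z ≠ 0 := fun z hz h => by
      have := re_one_sub_mul_pos hc (mem_ball_zero_iff.1 hz)
      rw [h, Complex.zero_re] at this
      exact lt_irrefl _ this
    refine ⟨1 - Polynomial.C ((starRingEnd ℂ) a) * Polynomial.X,
      fun z => (z - a) / (1 - (starRingEnd ℂ) a * z), g,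
      DifferentiableOn.div (by fun_prop) (by fun_prop) hne, hg, fun z hz => ⟨?_, ?_, ?_⟩,
      fun z hz => ?_⟩
    · rw [mul_assoc, hg' z hz, div_mul_cancel₀ _ (hne z hz)]
      simp
    · simp [hg' z hz]
    · rw [norm_div]
      refine div_le_one_of_le₀ (abs_le_of_sq_le_sq' ?_ (norm_nonneg _)).2 (norm_nonneg _)
      have := normSq_one_sub_conj_mul a z
      rw [mem_ball_zero_iff] at hz
      have h1 : 0 ≤ (1 - ‖a‖ ^ 2) * (1 - ‖z‖ ^ 2) :=
        mul_nonneg (by nlinarith [norm_nonneg a]) (by nlinarith [norm_nonneg z])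
      linarith
    · have := normSq_one_sub_conj_mul a z
      rw [hz, one_pow, sub_self, mul_zero, sub_eq_zero] at this
      simpa using (sq_eq_sq₀ (norm_nonneg _) (norm_nonneg _)).1 this

lemma hasInnerOuterFactorization (q : Polynomial ℂ) : HasInnerOuterFactorization q := by
  rw [(IsAlgClosed.splits q).eq_prod_roots]
  refine (hasInnerOuterFactorization_C _).mul ?_
  induction q.roots using Multiset.induction_on with
  | empty => simpa using hasInnerOuterFactorization_C 1
  | cons a s ih =>
    rw [Multiset.map_cons, Multiset.prod_cons]
    exact (hasInnerOuterFactorization_X_sub_C a).mul ih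

lemma continuous_circleNorm_one {X : Type*} [TopologicalSpace X] [FirstCountableTopology X]
    [LocallyCompactSpace X] {u : X → UCircle → ℂ} (hu : Continuous (Function.uncurry u)) :
    Continuous fun x => circleNorm 1 (u x) := by
  have h : ∀ x, circleNorm 1 (u x) = ∫ t in (univ : Set UCircle), ‖u x t‖ ∂arcMeasure := fun x => by
    rw [setIntegral_univ]
    exact circleNorm_one (hu.comp (Continuous.prodMk_right x))
  simp only [h]
  exact continuous_parametric_integral_of_continuous (f := fun x t => ‖u x t‖) hu.norm isCompact_univ

/-- The factorization lives in the open disc only, so the product estimate is used at radii `σ` and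
`r σ`. There it bounds by the norm of `F = g²` rather than of `q`; as `σ → 1` the two norms agree
because `|F| = |q|` on the circle. -/
lemma circleNorm_one_dilate_one_sub_eval (q : Polynomial ℂ) {r : ℝ} (hr : 0 ≤ r) (hr1 : r ≤ 1) :
    circleNorm 1 (dilate (fun z => q.eval z) 1 - dilate (fun z => q.eval z) r) ^ 2 ≤
      4 * (circleNorm 1 (dilate (fun z => q.eval z) 1) ^ 2
        - circleNorm 1 (dilate (fun z => q.eval z) r) ^ 2) := by
  obtain ⟨F, b, g, hb, hg, h, h'⟩ := hasInnerOuterFactorization q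
  have hlt : ∀ σ ∈ Ioo (0 : ℝ) 1,
      circleNorm 1 (dilate (fun z => q.eval z) σ - dilate (fun z => q.eval z) (r * σ)) ^ 2 ≤
        4 * (circleNorm 1 (dilate (fun z => F.eval z) σ) ^ 2
          - circleNorm 1 (dilate (fun z => q.eval z) (r * σ)) ^ 2) := by
    intro σ hσ
    have hrσ : r * σ ≤ σ := mul_le_of_le_one_left hσ.1.le hr1
    have hrσ0 : 0 ≤ r * σ := mul_nonneg hr hσ.1.le
    have hq : ∀ x, 0 ≤ x → x < 1 → dilate (fun z => q.eval z) x = dilate (b * g * g) x :=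
      fun x hx hx1 => funext fun t =>
        (h _ (by rw [mem_ball_zero_iff, norm_mul_toCircle hx]; exact hx1)).1
    have hF : dilate (fun z => F.eval z) σ = dilate (g * g) σ := funext fun t =>
      ((h _ (by rw [mem_ball_zero_iff, norm_mul_toCircle hσ.1.le]; exact hσ.2)).2.1).symm
    rw [hq _ hσ.1.le hσ.2, hq _ hrσ0 (hrσ.trans_lt hσ.2), hF]
    exact circleNorm_one_dilate_mul_sub hb hg (fun z hz => (h z hz).2.2) hrσ0 hrσ hσ.2
  have hF1 : circleNorm 1 (dilate (fun z => F.eval z) 1)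
      = circleNorm 1 (dilate (fun z => q.eval z) 1) := by
    rw [circleNorm_one (continuous_dilate_eval _ _), circleNorm_one (continuous_dilate_eval _ _)]
    exact integral_congr_ae (Eventually.of_forall fun t =>
      h' _ (by rw [norm_mul_toCircle zero_le_one]))
  have hd : ∀ (P : Polynomial ℂ) (a : ℝ), Continuous (Function.uncurry
      fun (σ : ℝ) (t : UCircle) => dilate (fun z => P.eval z) (a * σ) t) := by
    intro P a
    exact P.continuous.comp (by fun_prop)
  have hd1 : ∀ P : Polynomial ℂ, Continuous (Function.uncurry
      fun (σ : ℝ) (t : UCircle) => dilate (fun z => P.eval z) σ t) := by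
    intro P
    simpa using hd P 1
  have c1 : Continuous fun σ : ℝ => circleNorm 1
      (dilate (fun z => q.eval z) σ - dilate (fun z => q.eval z) (r * σ)) :=
    continuous_circleNorm_one ((hd1 q).sub (hd q r))
  have c2 : Continuous fun σ : ℝ => circleNorm 1 (dilate (fun z => F.eval z) σ) :=
    continuous_circleNorm_one (hd1 F)
  have c3 : Continuous fun σ : ℝ => circleNorm 1 (dilate (fun z => q.eval z) (r * σ)) :=
    continuous_circleNorm_one (hd q r)
  have t1 := ((c1.pow 2).tendsto 1).mono_left (nhdsWithin_le_nhds (s := Iio 1))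
  have t2 := (((c2.pow 2).sub (c3.pow 2)).const_mul 4 |>.tendsto 1).mono_left
    (nhdsWithin_le_nhds (s := Iio 1))
  have := le_of_tendsto_of_tendsto t1 t2 (by
    filter_upwards [Ioo_mem_nhdsLT zero_lt_one] with σ hσ using hlt σ hσ)
  simpa only [Pi.pow_apply, Pi.sub_apply, mul_one, hF1] using this

lemma circleNorm_one_dilate_sub_eval (q : Polynomial ℂ) {r s : ℝ} (hr : 0 ≤ r) (hrs : r ≤ s) :
    circleNorm 1 (dilate (fun z => q.eval z) s - dilate (fun z => q.eval z) r) ^ 2 ≤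
      4 * (circleNorm 1 (dilate (fun z => q.eval z) s) ^ 2
        - circleNorm 1 (dilate (fun z => q.eval z) r) ^ 2) := by
  rcases (hr.trans hrs).eq_or_lt with rfl | hs
  · obtain rfl := le_antisymm hr hrs
    rw [sub_self, circleNorm, eLpNorm_zero]
    simp
  have key := circleNorm_one_dilate_one_sub_eval (q.comp (Polynomial.C (s : ℂ) * Polynomial.X))
    (div_nonneg hr hs.le) (div_le_one_of_le₀ hrs hs.le)
  have h : ∀ x : ℝ, dilate (fun z => (q.comp (Polynomial.C (s : ℂ) * Polynomial.X)).eval z) x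
      = dilate (fun z => q.eval z) (s * x) := fun x => funext fun t => by
    simp [dilate, mul_assoc]
  rwa [h, h, mul_one, mul_div_cancel₀ _ hs.ne'] at key

lemma circleNorm_one_dilate_sub {f : ℂ → ℂ} {R r s : ℝ}
    (hf : DifferentiableOn ℂ f (Metric.ball 0 R)) (hr : 0 ≤ r) (hrs : r ≤ s) (hs : s < R) :
    circleNorm 1 (dilate f s - dilate f r) ^ 2
      ≤ 4 * (circleNorm 1 (dilate f s) ^ 2 - circleNorm 1 (dilate f r) ^ 2) := by
  obtain ⟨q, hq⟩ := exists_polynomial_seq hf (hr.trans hrs) hs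
  obtain ⟨h1, h2⟩ := hq 1 le_rfl
  exact le_of_tendsto_of_tendsto' ((h2 s r (hr.trans hrs) le_rfl hr hrs).pow 2)
    ((((h1 s (hr.trans hrs) le_rfl).pow 2).sub ((h1 r hr hrs).pow 2)).const_mul 4)
    fun n => circleNorm_one_dilate_sub_eval (q n) hr hrs

/-! ### Uniform convexity and mean convergence of dilations -/

/-- The defect of midpoint convexity of `‖·‖ ^ P`. -/
def midpointDefect (P : ℝ) (a b : ℂ) : ℝ :=
  (‖a‖ ^ P + ‖b‖ ^ P) / 2 - ‖(1 / 2 : ℂ) * (a + b)‖ ^ P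

lemma norm_half_mul_add_le (a b : ℂ) : ‖(1 / 2 : ℂ) * (a + b)‖ ≤ (1 / 2 : ℝ) * (‖a‖ + ‖b‖) := by
  rw [norm_mul]
  have : ‖(1 / 2 : ℂ)‖ = 1 / 2 := by norm_num
  rw [this]
  exact mul_le_mul_of_nonneg_left (norm_add_le a b) (by norm_num)

lemma midpointDefect_nonneg {P : ℝ} (hP : 1 ≤ P) (a b : ℂ) : 0 ≤ midpointDefect P a b := by
  have h1 := (convexOn_rpow hP).2 (norm_nonneg a : ‖a‖ ∈ Ici (0 : ℝ)) (norm_nonneg b)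
    (by norm_num : (0 : ℝ) ≤ 1 / 2) (by norm_num : (0 : ℝ) ≤ 1 / 2) (by norm_num)
  simp only [smul_eq_mul, ← mul_add] at h1
  have h2 := Real.rpow_le_rpow (norm_nonneg _) (norm_half_mul_add_le a b) (by linarith : 0 ≤ P)
  rw [midpointDefect]
  linarith

lemma midpointDefect_pos {P : ℝ} (hP : 1 < P) {a b : ℂ} (hab : a ≠ b) :
    0 < midpointDefect P a b := by
  have hP0 : 0 < P := by linarith
  rw [midpointDefect]
  by_cases h : ‖a‖ = ‖b‖
  · have h1 : ‖(1 / 2 : ℂ) * (a + b)‖ < ‖a‖ := by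
      have := (norm_midpoint_lt_iff h).2 hab
      rwa [Complex.real_smul, Complex.ofReal_div, Complex.ofReal_one, Complex.ofReal_ofNat] at this
    have h2 := Real.rpow_lt_rpow (norm_nonneg _) h1 hP0
    rw [← h]
    linarith
  · have h1 := (strictConvexOn_rpow hP).2 (norm_nonneg a : ‖a‖ ∈ Ici (0 : ℝ)) (norm_nonneg b) h
      (by norm_num : (0 : ℝ) < 1 / 2) (by norm_num : (0 : ℝ) < 1 / 2) (by norm_num)
    simp only [smul_eq_mul, ← mul_add] at h1
    have h2 := Real.rpow_le_rpow (norm_nonneg _) (norm_half_mul_add_le a b) hP0.le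
    linarith

/-- Uniform convexity in pointwise form, ready for integration. By homogeneity one may take `‖a‖^P +
‖b‖^P = 1`. Where `‖a - b‖^P ≥ δ`, the defect is positive on a compact set, hence at least some `c >
0`, and `‖a - b‖^P ≤ 2^P`; so `C = 2^P / c` works. -/
lemma exists_norm_sub_rpow_le {P δ : ℝ} (hP : 1 < P) (hδ : 0 < δ) : ∃ C : ℝ, 0 ≤ C ∧ ∀ a b : ℂ,
    ‖a - b‖ ^ P ≤ δ * (‖a‖ ^ P + ‖b‖ ^ P) + C * midpointDefect P a b := by
  have hP0 : 0 < P := by linarith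
  have hcr : ∀ {f : ℂ × ℂ → ℂ}, Continuous f → Continuous fun x => ‖f x‖ ^ P := fun hf =>
    hf.norm.rpow_const fun _ => Or.inr hP0.le
  have ca := hcr continuous_fst
  have cb := hcr continuous_snd
  have cs := hcr (continuous_fst.sub continuous_snd)
  have cm : Continuous fun x : ℂ × ℂ => midpointDefect P x.1 x.2 :=
    ((ca.add cb).div_const 2).sub (hcr (continuous_const.mul (continuous_fst.add continuous_snd)))
  set K : Set (ℂ × ℂ) := {x | ‖x.1‖ ^ P + ‖x.2‖ ^ P = 1 ∧ δ ≤ ‖x.1 - x.2‖ ^ P} with hK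
  have hle1 : ∀ {x y : ℝ}, 0 ≤ x → 0 ≤ y → x ^ P + y ^ P = 1 → x ≤ 1 := by
    intro x y hx hy h
    by_contra hx1
    have := Real.one_lt_rpow (not_le.1 hx1) hP0
    linarith [Real.rpow_nonneg hy P]
  have hKc : IsCompact K := by
    refine Metric.isCompact_of_isClosed_isBounded
      ((isClosed_eq (ca.add cb) continuous_const).inter (isClosed_le continuous_const cs)) ?_
    refine (Metric.isBounded_closedBall (x := (0 : ℂ × ℂ)) (r := 1)).subset fun x hx => ?_
    rw [mem_closedBall_zero_iff, Prod.norm_def]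
    exact max_le (hle1 (norm_nonneg _) (norm_nonneg _) hx.1)
      (hle1 (norm_nonneg _) (norm_nonneg _) ((add_comm _ _).trans hx.1))
  obtain ⟨c, hc, hcK⟩ : ∃ c : ℝ, 0 < c ∧ ∀ x ∈ K, c ≤ midpointDefect P x.1 x.2 := by
    rcases K.eq_empty_or_nonempty with h | h
    · exact ⟨1, one_pos, by simp [h]⟩
    · obtain ⟨x, hx, hmin⟩ := hKc.exists_isMinOn h cm.continuousOn
      refine ⟨_, midpointDefect_pos hP fun he => ?_, fun y hy => hmin hy⟩
      have := hx.2
      rw [he, sub_self, norm_zero, Real.zero_rpow hP0.ne'] at this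
      linarith
  have h2 : (0 : ℝ) < 2 ^ P := Real.rpow_pos_of_pos two_pos P
  have hone : ∀ a b : ℂ, ‖a‖ ^ P + ‖b‖ ^ P = 1 →
      ‖a - b‖ ^ P ≤ δ + 2 ^ P / c * midpointDefect P a b := by
    intro a b hab
    have h0 := midpointDefect_nonneg hP.le a b
    by_cases hd : δ ≤ ‖a - b‖ ^ P
    · have h1 : ‖a - b‖ ≤ 2 := (norm_sub_le a b).trans (by
        linarith [hle1 (norm_nonneg _) (norm_nonneg _) hab,
          hle1 (norm_nonneg _) (norm_nonneg _) ((add_comm _ _).trans hab)])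
      have h3 := Real.rpow_le_rpow (norm_nonneg _) h1 hP0.le
      have h4 := mul_le_mul_of_nonneg_left (hcK (a, b) ⟨hab, hd⟩) (div_pos h2 hc).le
      rw [div_mul_cancel₀ _ hc.ne'] at h4
      linarith
    · have := mul_nonneg (div_pos h2 hc).le h0
      linarith
  refine ⟨2 ^ P / c, (div_pos h2 hc).le, fun a b => ?_⟩
  set S := ‖a‖ ^ P + ‖b‖ ^ P with hS
  have ha0 := Real.rpow_nonneg (norm_nonneg a) P
  have hb0 := Real.rpow_nonneg (norm_nonneg b) P
  rcases (show 0 ≤ S by positivity).eq_or_lt with h0 | hSpos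
  · have ha : a = 0 := by
      have : ‖a‖ ^ P = 0 := by linarith
      rwa [Real.rpow_eq_zero (norm_nonneg _) hP0.ne', norm_eq_zero] at this
    have hb : b = 0 := by
      have : ‖b‖ ^ P = 0 := by linarith
      rwa [Real.rpow_eq_zero (norm_nonneg _) hP0.ne', norm_eq_zero] at this
    have := mul_nonneg (div_pos h2 hc).le (midpointDefect_nonneg hP.le a b)
    rw [← h0, mul_zero, zero_add]
    simpa [ha, hb, Real.zero_rpow hP0.ne'] using this
  · set k : ℝ := S ^ (-P⁻¹) with hk
    have hk0 : 0 ≤ k := Real.rpow_nonneg hSpos.le _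
    have hkP : k ^ P = S⁻¹ := by
      rw [hk, ← Real.rpow_mul hSpos.le, neg_mul, inv_mul_cancel₀ hP0.ne', Real.rpow_neg_one]
    have hsc : ∀ z : ℂ, ‖(k : ℂ) * z‖ ^ P = S⁻¹ * ‖z‖ ^ P := fun z => by
      rw [norm_mul, Complex.norm_real, Real.norm_of_nonneg hk0, Real.mul_rpow hk0 (norm_nonneg _),
        hkP]
    have h := hone (k * a) (k * b) (by
      rw [hsc, hsc, ← mul_add, ← hS, inv_mul_cancel₀ hSpos.ne'])
    have hm : midpointDefect P (k * a) (k * b) = S⁻¹ * midpointDefect P a b := by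
      rw [midpointDefect, midpointDefect, ← mul_add, mul_left_comm, hsc, hsc, hsc]
      ring
    rw [← mul_sub, hsc, hm] at h
    have := mul_le_mul_of_nonneg_left h hSpos.le
    rw [mul_inv_cancel_left₀ hSpos.ne'] at this
    refine this.trans_eq ?_
    field_simp

lemma exists_circleNorm_sub_rpow_le {p : ℝ≥0∞} (hp : 1 < p) (hp' : p ≠ ∞) {δ : ℝ} (hδ : 0 < δ) :
    ∃ C : ℝ, 0 ≤ C ∧ ∀ u v : UCircle → ℂ, Continuous u → Continuous v →
      circleNorm p (u - v) ^ p.toReal ≤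
        δ * (circleNorm p u ^ p.toReal + circleNorm p v ^ p.toReal)
        + C * ((circleNorm p u ^ p.toReal + circleNorm p v ^ p.toReal) / 2
          - circleNorm p ((1 / 2 : ℂ) • (u + v)) ^ p.toReal) := by
  have hP : 1 < p.toReal := by
    rw [← ENNReal.toReal_one]
    exact (ENNReal.toReal_lt_toReal ENNReal.one_ne_top hp').2 hp
  obtain ⟨C, hC0, hC⟩ := exists_norm_sub_rpow_le hP hδ
  refine ⟨C, hC0, fun u v hu hv => ?_⟩
  have hw : Continuous ((1 / 2 : ℂ) • (u + v)) := (hu.add hv).const_smul _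
  have hi : ∀ {w : UCircle → ℂ}, Continuous w →
      Integrable (fun t => ‖w t‖ ^ p.toReal) arcMeasure := fun hw =>
    integrable_of_continuous (hw.norm.rpow_const fun _ => Or.inr (by linarith))
  simp only [circleNorm_rpow hp.le hp' hu, circleNorm_rpow hp.le hp' hv,
    circleNorm_rpow hp.le hp' hw, circleNorm_rpow hp.le hp' (hu.sub hv)]
  have i1 : Integrable (fun t => ‖u t‖ ^ p.toReal + ‖v t‖ ^ p.toReal) arcMeasure :=
    (hi hu).add (hi hv)
  have i2 : Integrable (fun t => (‖u t‖ ^ p.toReal + ‖v t‖ ^ p.toReal) / 2) arcMeasure :=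
    i1.div_const 2
  have i3 : Integrable (fun t => (‖u t‖ ^ p.toReal + ‖v t‖ ^ p.toReal) / 2
      - ‖((1 / 2 : ℂ) • (u + v)) t‖ ^ p.toReal) arcMeasure := i2.sub (hi hw)
  rw [← integral_add (hi hu) (hi hv), ← integral_const_mul, ← integral_div,
    ← integral_sub i2 (hi hw), ← integral_const_mul,
    ← integral_add (i1.const_mul δ) (i3.const_mul C)]
  exact integral_mono (hi (hu.sub hv)) ((i1.const_mul δ).add (i3.const_mul C))
    fun t => hC (u t) (v t)

lemma differentiableOn_comp_mul {f : ℂ → ℂ} (hf : DifferentiableOn ℂ f (Metric.ball 0 1)) {x R : ℝ}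
    (hx : 0 ≤ x) (hR : x * R ≤ 1) : DifferentiableOn ℂ (fun z => f (x * z)) (Metric.ball 0 R) := by
  rcases hx.eq_or_lt with rfl | hx
  · simp
  refine hf.comp (by fun_prop) fun z hz => ?_
  rw [mem_ball_zero_iff] at hz ⊢
  rw [norm_mul, Complex.norm_real, Real.norm_of_nonneg hx.le]
  exact (mul_lt_mul_of_pos_left hz hx).trans_le hR

lemma dilate_comp_mul (f : ℂ → ℂ) (x r : ℝ) :
    dilate (fun z => f (x * z)) r = dilate f (x * r) := by
  funext t
  simp [dilate, mul_assoc]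

/-- The mean of two dilations close to `f` has norm bounded below. -/
lemma exists_circleNorm_le_midpoint {p : ℝ≥0∞} [hp : Fact (1 ≤ p)] {f : ℂ → ℂ}
    (hf : DifferentiableOn ℂ f (Metric.ball 0 1)) {ρ κ : ℝ} (hρ : ρ ∈ Ioo (0 : ℝ) 1) (hκ : 0 < κ) :
    ∃ R ∈ Ioo (0 : ℝ) 1, ∀ r s, R ≤ r → r < 1 → R ≤ s → s < 1 →
      circleNorm p (dilate f ρ) ≤ circleNorm p ((1 / 2 : ℂ) • (dilate f s + dilate f r)) + κ := by
  have huc := (isCompact_closedBall (0 : ℂ) ρ).uniformContinuousOn_of_continuous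
    (hf.continuousOn.mono (Metric.closedBall_subset_ball hρ.2))
  obtain ⟨d, hd, hd'⟩ := Metric.uniformContinuousOn_iff.1 huc κ hκ
  refine ⟨max (1 / 2) (1 - d / 2), ⟨by positivity, max_lt (by norm_num) (by linarith)⟩,
    fun r s hr hr1 hs hs1 => ?_⟩
  have hclose : ∀ x, max (1 / 2) (1 - d / 2) ≤ x → x < 1 → ∀ t,
      ‖dilate f ρ t - dilate f (x * ρ) t‖ ≤ κ := by
    intro x hx hx1 t
    have hx0 : 0 ≤ x := (by norm_num : (0 : ℝ) ≤ 1 / 2).trans ((le_max_left _ _).trans hx)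
    have hxρ : 0 ≤ x * ρ := mul_nonneg hx0 hρ.1.le
    rw [← dist_eq_norm]
    refine (hd' _ ?_ _ ?_ ?_).le
    · rw [mem_closedBall_zero_iff, norm_mul_toCircle hρ.1.le]
    · rw [mem_closedBall_zero_iff, norm_mul_toCircle hxρ]
      exact mul_le_of_le_one_left hρ.1.le hx1.le
    · have : (ρ : ℂ) * t.toCircle - ((x * ρ : ℝ) : ℂ) * t.toCircle
          = (((1 - x) * ρ : ℝ) : ℂ) * t.toCircle := by
        push_cast
        ring
      rw [dist_eq_norm, this, norm_mul_toCircle (mul_nonneg (by linarith) hρ.1.le)]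
      have h1 : 1 - x ≤ d / 2 := by linarith [(le_max_right (1 / 2) (1 - d / 2)).trans hx]
      have h2 : (1 - x) * ρ ≤ 1 - x := mul_le_of_le_one_right (by linarith) hρ.2.le
      linarith
  have h12 : ∀ x, max (1 / 2) (1 - d / 2) ≤ x → 0 < x := fun x hx =>
    (by norm_num : (0 : ℝ) < 1 / 2).trans_le ((le_max_left _ _).trans hx)
  have hr0 := h12 r hr
  have hs0 := h12 s hs
  set m := max r s with hm
  have hm0 : 0 < m := hr0.trans_le (le_max_left _ _)
  have hm1 : m < 1 := max_lt hr1 hs1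
  -- The midpoint of the dilations is the circle restriction of `H`, which is holomorphic beyond the
  -- closed unit disc. Its mean at radius `1` therefore dominates the one at radius `ρ`, where `H`
  -- is uniformly close to `f`.
  set H : ℂ → ℂ := fun z => (1 / 2 : ℂ) * (f (s * z) + f (r * z)) with hH
  have hdH : DifferentiableOn ℂ H (Metric.ball 0 m⁻¹) := by
    refine (differentiableOn_const _).mul ((differentiableOn_comp_mul hf hs0.le ?_).add
      (differentiableOn_comp_mul hf hr0.le ?_))
    · rw [← div_eq_mul_inv, div_le_one hm0]
      exact le_max_right _ _
    · rw [← div_eq_mul_inv, div_le_one hm0]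
      exact le_max_left _ _
  have hHx : ∀ x : ℝ, dilate H x = (1 / 2 : ℂ) • (dilate f (s * x) + dilate f (r * x)) := by
    intro x
    rw [← dilate_comp_mul, ← dilate_comp_mul]
    rfl
  have hmi : 1 < m⁻¹ := (one_lt_inv₀ hm0).2 hm1
  have hmono := circleNorm_dilate_mono (p := p) hdH hρ.1.le hρ.2.le hmi
  rw [hHx 1, mul_one, mul_one] at hmono
  have hsub : circleNorm p (dilate f ρ - dilate H ρ) ≤ κ := by
    refine circleNorm_le_of_bound hκ.le fun t => ?_
    have e : (dilate f ρ - dilate H ρ) t = (1 / 2 : ℂ) *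
        ((dilate f ρ t - dilate f (s * ρ) t) + (dilate f ρ t - dilate f (r * ρ) t)) := by
      rw [hHx]
      simp only [Pi.sub_apply, Pi.smul_apply, Pi.add_apply, smul_eq_mul]
      ring
    rw [e]
    refine (norm_half_mul_add_le _ _).trans ?_
    linarith [hclose s hs hs1 t, hclose r hr hr1 t]
  have cH := continuous_dilate_of_lt hdH hρ.1.le (hρ.2.trans hmi)
  have := circleNorm_add_le hp.out ((continuous_dilate_of_lt hf hρ.1.le hρ.2).sub cH) cH
  rw [sub_add_cancel] at this
  linarith

/-- The dilations of a function in the Hardy class form a Cauchy family in `L^p`. -/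
lemma exists_circleNorm_dilate_sub_le {p : ℝ≥0∞} [hp : Fact (1 ≤ p)] (hp' : p ≠ ∞) {f : ℂ → ℂ}
    (hf : DifferentiableOn ℂ f (Metric.ball 0 1)) {B : ℝ}
    (hB : ∀ r ∈ Ioo (0 : ℝ) 1, circleNorm p (dilate f r) ≤ B) {ε : ℝ} (hε : 0 < ε) :
    ∃ R ∈ Ioo (0 : ℝ) 1, ∀ r s, R ≤ r → r ≤ s → s < 1 →
      circleNorm p (dilate f s - dilate f r) ≤ ε := by
  set L := sSup ((fun r => circleNorm p (dilate f r)) '' Ioo 0 1) with hL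
  have hbdd : BddAbove ((fun r => circleNorm p (dilate f r)) '' Ioo 0 1) :=
    ⟨B, by rintro _ ⟨r, hr, rfl⟩; exact hB r hr⟩
  have hle : ∀ r ∈ Ioo (0 : ℝ) 1, circleNorm p (dilate f r) ≤ L := fun r hr =>
    le_csSup hbdd ⟨r, hr, rfl⟩
  have hnear : ∀ η > 0, ∃ ρ ∈ Ioo (0 : ℝ) 1, L - η < circleNorm p (dilate f ρ) := by
    intro η hη
    obtain ⟨_, ⟨ρ, hρ, rfl⟩, h⟩ := exists_lt_of_lt_csSup
      ((nonempty_Ioo.2 (zero_lt_one (α := ℝ))).image _) (show L - η < _ by rw [← hL]; linarith)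
    exact ⟨ρ, hρ, h⟩
  have hL0 : 0 ≤ L := circleNorm_nonneg.trans (hle (1 / 2) ⟨by norm_num, by norm_num⟩)
  rcases hp.out.eq_or_lt with rfl | hp1
  -- If both norms lie in `[L - η, L]`, the bound `4 (a² - b²) = 4 (a - b)(a + b)` is at most `8 L
  -- η`. The `+ 1` covers `L = 0`.
  · set η := ε ^ 2 / (8 * L + 1) with hη
    have hη0 : 0 < η := by positivity
    have hη1 : 8 * L * η ≤ ε ^ 2 := by
      rw [hη, mul_div_assoc', div_le_iff₀ (by positivity)]
      nlinarith [sq_nonneg ε]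
    obtain ⟨R, hR, hRL⟩ := hnear η hη0
    refine ⟨R, hR, fun r s hr hrs hs => ?_⟩
    have h1 := circleNorm_one_dilate_sub hf (hR.1.le.trans hr) hrs hs
    have h2 := circleNorm_dilate_mono (p := 1) hf hR.1.le hr (hrs.trans_lt hs)
    have h3 := circleNorm_dilate_mono (p := 1) hf (hR.1.le.trans hr) hrs hs
    have h4 := hle s ⟨hR.1.trans_le (hr.trans hrs), hs⟩
    have h5 := circleNorm_nonneg (p := 1) (u := dilate f r)
    refine abs_le_of_sq_le_sq' ?_ hε.le |>.2
    refine h1.trans (le_trans ?_ hη1)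
    generalize circleNorm 1 (dilate f s) = a at *
    generalize circleNorm 1 (dilate f r) = b at *
    nlinarith [mul_nonneg (show 0 ≤ η - (a - b) by linarith) (show 0 ≤ a + b by linarith)]
  · have hP : 0 < p.toReal := ENNReal.toReal_pos (zero_lt_one.trans hp1).ne' hp'
    set P := p.toReal with hPdef
    have hεP : 0 < ε ^ P := Real.rpow_pos_of_pos hε P
    have hLP : 0 ≤ L ^ P := Real.rpow_nonneg hL0 P
    obtain ⟨C, hC0, hC⟩ := exists_circleNorm_sub_rpow_le hp1 hp'
      (show 0 < ε ^ P / (4 * (L ^ P + 1)) by positivity)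
    -- Truncation at `0` keeps the base of the real power nonnegative when `η > L`.
    have hcont : Tendsto (fun η : ℝ => L ^ P - max (L - η) 0 ^ P) (𝓝[>] 0) (𝓝 0) := by
      have : Continuous fun η : ℝ => L ^ P - max (L - η) 0 ^ P :=
        continuous_const.sub (((continuous_const.sub continuous_id).max
          continuous_const).rpow_const fun _ => Or.inr hP.le)
      have h0 := (this.tendsto 0).mono_left (nhdsWithin_le_nhds (s := Ioi 0))
      simpa [max_eq_left hL0] using h0
    obtain ⟨η, hηsmall, hη⟩ := ((hcont.eventually_lt_const
      (show 0 < ε ^ P / (2 * (C + 1)) by positivity)).and self_mem_nhdsWithin).exists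
    replace hη : 0 < η := hη
    -- Half of `η` is lost in choosing `ρ` and half in comparing with the midpoint, so the midpoint
    -- has norm at least `L - η`.
    obtain ⟨ρ, hρ, hρL⟩ := hnear (η / 2) (half_pos hη)
    obtain ⟨R, hR, hmid⟩ := exists_circleNorm_le_midpoint (p := p) hf hρ (half_pos hη)
    refine ⟨R, hR, fun r s hr hrs hs => ?_⟩
    have hr1 := hrs.trans_lt hs
    have hr0 := hR.1.trans_le hr
    have hs0 := hr0.trans_le hrs
    have h1 := hC _ _ (continuous_dilate_of_lt hf hs0.le hs) (continuous_dilate_of_lt hf hr0.le hr1)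
    have h2 := hmid r s hr hr1 (hr.trans hrs) hs
    have h3 := Real.rpow_le_rpow circleNorm_nonneg (hle s ⟨hs0, hs⟩) hP.le
    have h4 := Real.rpow_le_rpow circleNorm_nonneg (hle r ⟨hr0, hr1⟩) hP.le
    have h5 : max (L - η) 0 ^ P
        ≤ circleNorm p ((1 / 2 : ℂ) • (dilate f s + dilate f r)) ^ P :=
      Real.rpow_le_rpow (le_max_right _ _) (max_le (by linarith) circleNorm_nonneg) hP.le
    refine (Real.rpow_le_rpow_iff circleNorm_nonneg hε.le hP).1 (h1.trans ?_)
    generalize circleNorm p (dilate f s) ^ P = a at *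
    generalize circleNorm p (dilate f r) ^ P = b at *
    generalize circleNorm p ((1 / 2 : ℂ) • (dilate f s + dilate f r)) ^ P = c at *
    have e1 : ε ^ P / (4 * (L ^ P + 1)) * (a + b) ≤ ε ^ P / 2 := by
      rw [div_mul_eq_mul_div, div_le_iff₀ (by positivity)]
      nlinarith
    have e2 : C * ((a + b) / 2 - c) ≤ ε ^ P / 2 := by
      have : C * ((a + b) / 2 - c) ≤ C * (ε ^ P / (2 * (C + 1))) :=
        mul_le_mul_of_nonneg_left (by linarith) hC0
      refine this.trans ?_
      rw [mul_div_assoc', div_le_div_iff₀ (by positivity) two_pos]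
      nlinarith
    linarith

/-- Polynomials are dense in the Hardy class. -/
lemma exists_polynomial_circleNorm_sub_le {p : ℝ≥0∞} [hp : Fact (1 ≤ p)] (hp' : p ≠ ∞) {f : ℂ → ℂ}
    (hf : DifferentiableOn ℂ f (Metric.ball 0 1)) {B : ℝ}
    (hB : ∀ r ∈ Ioo (0 : ℝ) 1, circleNorm p (dilate f r) ≤ B) {ε : ℝ} (hε : 0 < ε) :
    ∃ q : Polynomial ℂ, ∀ r ∈ Ioo (0 : ℝ) 1,
      circleNorm p (dilate f r - dilate (fun z => q.eval z) r) ≤ ε := by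
  obtain ⟨R, hR, h⟩ := exists_circleNorm_dilate_sub_le hp' hf hB (half_pos hε)
  -- The intermediate function `z ↦ f(x z)` is holomorphic across the circle, hence uniformly
  -- approximable by polynomials on the closed disc; `x > R` makes it close to `f` in norm.
  obtain ⟨x, hRx, hx1⟩ := exists_between hR.2
  have hx0 : 0 < x := hR.1.trans hRx
  have hdx : DifferentiableOn ℂ (fun z => f (x * z)) (Metric.ball 0 x⁻¹) :=
    differentiableOn_comp_mul hf hx0.le (mul_inv_cancel₀ hx0.ne').le
  obtain ⟨q, hq⟩ := exists_polynomial_near hdx zero_le_one ((one_lt_inv₀ hx0).2 hx1) (half_pos hε)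
  refine ⟨q, fun r hr => ?_⟩
  have hxr : x * r < 1 := mul_lt_one_of_nonneg_of_lt_one_left hx0.le hx1 hr.2.le
  have c1 := continuous_dilate_of_lt hf hr.1.le hr.2
  have c2 := continuous_dilate_of_lt hf (mul_nonneg hx0.le hr.1.le) hxr
  have h1 : circleNorm p (dilate f r - dilate f (x * r)) ≤ ε / 2 := by
    -- For small `r` the Cauchy estimate does not apply directly. Monotonicity of the means of `f -
    -- f(x ·)` raises `r` to `s`, for which `x s ≥ R`.
    set s := max r (R / x) with hs
    have hs1 : s < 1 := max_lt hr.2 ((div_lt_one hx0).2 hRx)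
    have hs0 : 0 < s := hr.1.trans_le (le_max_left _ _)
    have hdiff : DifferentiableOn ℂ (fun z => f z - f (x * z)) (Metric.ball 0 1) :=
      hf.sub (differentiableOn_comp_mul hf hx0.le (by linarith))
    have hdil : ∀ y : ℝ, dilate (fun z => f z - f (x * z)) y = dilate f y - dilate f (x * y) := by
      intro y
      rw [← dilate_comp_mul]
      rfl
    have hmono := circleNorm_dilate_mono (p := p) hdiff hr.1.le (le_max_left r (R / x)) hs1
    rw [hdil, hdil] at hmono
    refine hmono.trans (h _ _ ?_ (mul_le_of_le_one_left hs0.le hx1.le) hs1)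
    rw [← div_le_iff₀' hx0]
    exact le_max_right _ _
  have h2 : circleNorm p (dilate f (x * r) - dilate (fun z => q.eval z) r) ≤ ε / 2 := by
    rw [← dilate_comp_mul]
    exact circleNorm_le_of_bound (half_pos hε).le fun t =>
      (hq _ (by rw [norm_mul_toCircle hr.1.le]; exact hr.2.le)).le
  have h3 := circleNorm_add_le hp.out (c1.sub c2) (c2.sub (continuous_dilate_eval q r))
  rw [sub_add_sub_cancel] at h3
  linarith

/-! ### Polynomials of small norm with prescribed values on a closed null set -/

lemma dilate_one_apply (f : ℂ → ℂ) (t : UCircle) : dilate f 1 t = f t.toCircle := by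
  rw [dilate, Complex.ofReal_one, one_mul]

lemma fourier_eq_zpow (n : ℤ) (t : UCircle) : fourier n t = (t.toCircle : ℂ) ^ n := by
  rw [fourier_apply, AddCircle.toCircle_zsmul, Circle.coe_zpow]

/-- Negative frequencies are reflected by conjugation, which preserves real parts: `Re (c z̄^k) = Re
(c̄ z^k)` on the circle. The free factor `c` lets the induction pass through complex scalars. -/
lemma exists_polynomial_re_eq {w : C(UCircle, ℂ)}
    (hw : w ∈ Submodule.span ℂ (range (fourier (T := 2 * Real.pi)))) (c : ℂ) :
    ∃ F : Polynomial ℂ, ∀ t : UCircle, (F.eval (t.toCircle : ℂ)).re = (c * w t).re := by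
  induction hw using Submodule.span_induction generalizing c with
  | mem x hx =>
    obtain ⟨n, rfl⟩ := hx
    obtain ⟨k, rfl | rfl⟩ := n.eq_nat_or_neg
    · refine ⟨Polynomial.monomial k c, fun t => ?_⟩
      rw [Polynomial.eval_monomial, fourier_eq_zpow, zpow_natCast]
    · refine ⟨Polynomial.monomial k ((starRingEnd ℂ) c), fun t => ?_⟩
      rw [Polynomial.eval_monomial, fourier_neg, fourier_eq_zpow, zpow_natCast,
        ← Complex.conj_re (c * _), map_mul, Complex.conj_conj]
  | zero => exact ⟨0, fun t => by simp⟩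
  | add x y _ _ hx hy =>
    obtain ⟨F, hF⟩ := hx c
    obtain ⟨G, hG⟩ := hy c
    exact ⟨F + G, fun t => by
      rw [Polynomial.eval_add, Complex.add_re, hF, hG, ContinuousMap.add_apply, mul_add,
        Complex.add_re]⟩
  | smul a x _ hx =>
    obtain ⟨F, hF⟩ := hx (c * a)
    exact ⟨F, fun t => by rw [hF, ContinuousMap.smul_apply, smul_eq_mul, mul_assoc]⟩

/-- Real parts of polynomials are uniformly dense in the real continuous functions on the circle. -/
lemma exists_polynomial_re_near (u : C(UCircle, ℝ)) {η : ℝ} (hη : 0 < η) :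
    ∃ F : Polynomial ℂ, ∀ t : UCircle, |(F.eval (t.toCircle : ℂ)).re - u t| < η := by
  set w : C(UCircle, ℂ) := ⟨fun t => (u t : ℂ), by fun_prop⟩ with hw
  have hmem : w ∈ (Submodule.span ℂ (range (fourier (T := 2 * Real.pi)))).topologicalClosure := by
    rw [span_fourier_closure_eq_top]
    trivial
  obtain ⟨v, hv, hvw⟩ := Metric.mem_closure_iff.1 hmem η hη
  obtain ⟨F, hF⟩ := exists_polynomial_re_eq hv 1
  refine ⟨F, fun t => ?_⟩
  rw [dist_comm, ContinuousMap.dist_lt_iff hη] at hvw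
  have h := hvw t
  rw [dist_eq_norm] at h
  have e : (F.eval (t.toCircle : ℂ)).re - u t = (v t - w t).re := by
    rw [hF, one_mul, Complex.sub_re]
    rfl
  rw [e]
  exact (Complex.abs_re_le_norm _).trans_lt h

lemma exists_continuous_small_integral {E : Set UCircle} (hE : IsClosed E)
    (hE0 : arcMeasure E = 0) {M c : ℝ} (hM : 0 ≤ M) (hc : 0 < c) :
    ∃ u : C(UCircle, ℝ), (∀ t, 0 ≤ u t) ∧ (∀ t ∈ E, u t = M) ∧ ∫ t, u t ∂arcMeasure ≤ M * c := by
  obtain ⟨U, hEU, hU, hUc⟩ := E.exists_isOpen_lt_of_lt (μ := arcMeasure) (ENNReal.ofReal c)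
    (by rw [hE0]; exact ENNReal.ofReal_pos.2 hc)
  obtain ⟨f, hf0, hf1, hf⟩ := exists_continuous_zero_one_of_isClosed hU.isClosed_compl hE
    (disjoint_compl_left_iff_subset.2 hEU)
  refine ⟨M • f, fun t => mul_nonneg hM (hf t).1, fun t ht => ?_, ?_⟩
  · rw [ContinuousMap.smul_apply, hf1 ht, Pi.one_apply, smul_eq_mul, mul_one]
  · have h1 : ∫ t, f t ∂arcMeasure ≤ ∫ t, U.indicator 1 t ∂arcMeasure := by
      refine integral_mono (integrable_of_continuous f.continuous)
        ((integrable_const (1 : ℝ)).indicator hU.measurableSet) fun t => ?_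
      by_cases ht : t ∈ U
      · rw [indicator_of_mem ht]
        exact (hf t).2
      · rw [indicator_of_notMem ht, hf0 ht]
        rfl
    rw [integral_indicator_one hU.measurableSet] at h1
    have h2 : arcMeasure.real U ≤ c := ENNReal.toReal_le_of_le_ofReal hc.le hUc.le
    simp only [ContinuousMap.smul_apply, smul_eq_mul, integral_const_mul]
    exact mul_le_mul_of_nonneg_left (h1.trans h2) hM

/-- A polynomial with nonnegative real part on the circle, large real part on `E` and a small
positive value at the origin. -/
lemma exists_polynomial_large_re {E : Set UCircle} (hE : IsClosed E)
    (hE0 : arcMeasure E = 0) {M a : ℝ} (hM : 0 ≤ M) (ha : 0 < a) :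
    ∃ F : Polynomial ℂ, (∀ t : UCircle, 0 ≤ (F.eval (t.toCircle : ℂ)).re) ∧
      (∀ t ∈ E, M ≤ (F.eval (t.toCircle : ℂ)).re) ∧ ∃ x : ℝ, F.eval 0 = x ∧ x ≤ a := by
  obtain ⟨u, hu0, huM, hui⟩ := exists_continuous_small_integral hE hE0 hM
    (show 0 < a / (2 * (M + 1)) by positivity)
  have hη : 0 < a / 4 := by positivity
  -- Lifting `u` by `a / 4` absorbs an approximation error of `a / 4`: the real part stays above
  -- `u`, and below `u + a / 2`.
  obtain ⟨F, hF⟩ := exists_polynomial_re_near (u + ContinuousMap.const _ (a / 4)) hη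
  simp only [ContinuousMap.add_apply, ContinuousMap.const_apply, abs_lt] at hF
  -- Subtracting an imaginary constant makes the value at the origin real without changing real
  -- parts.
  set G := F - Polynomial.C ((F.eval 0).im * Complex.I) with hG
  have hre : ∀ z, (G.eval z).re = (F.eval z).re := fun z => by simp [hG]
  refine ⟨G, fun t => ?_, fun t ht => ?_, (G.eval 0).re, ?_, ?_⟩
  · rw [hre]
    linarith [hF t, hu0 t]
  · rw [hre]
    linarith [hF t, huM t ht]
  · refine Complex.ext (by simp) (by simp [hG])
  · rw [hre]
    have hc : Continuous fun t : UCircle => F.eval (t.toCircle : ℂ) := by fun_prop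
    have h1 : ∫ t : UCircle, F.eval (t.toCircle : ℂ) ∂arcMeasure = F.eval 0 := by
      have := integral_dilate (f := fun z => F.eval z) (R := 2) (r := 1)
        F.differentiable.differentiableOn zero_le_one one_lt_two
      simpa only [dilate_one_apply] using this
    have h2 : (F.eval 0).re = ∫ t : UCircle, (F.eval (t.toCircle : ℂ)).re ∂arcMeasure := by
      rw [← h1]
      exact (integral_re (𝕜 := ℂ) (integrable_of_continuous hc)).symm
    have h3 : ∫ t : UCircle, (F.eval (t.toCircle : ℂ)).re ∂arcMeasure
        ≤ ∫ t : UCircle, (u t + a / 2) ∂arcMeasure :=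
      integral_mono (integrable_of_continuous (Complex.continuous_re.comp hc))
        (integrable_of_continuous (u.continuous.add continuous_const))
        fun t => by linarith [hF t]
    rw [integral_add (integrable_of_continuous u.continuous) (integrable_const _), integral_const,
      probReal_univ, one_smul] at h3
    have h4 : M * (a / (2 * (M + 1))) ≤ a / 2 := by
      rw [mul_div_assoc', div_le_div_iff₀ (by positivity) two_pos]
      nlinarith
    linarith

/-- With `w = exp (-F)` and `|w| ≤ 1`, `|1 - w|² ≤ 2 - 2 Re w`. The mean value property gives `∫ Re
w = exp (-x)`, and `1 - x ≤ exp (-x)`. -/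
lemma integral_normSq_one_sub_exp_neg_le {F : Polynomial ℂ}
    (hF : ∀ t : UCircle, 0 ≤ (F.eval (t.toCircle : ℂ)).re) {x : ℝ} (hx : F.eval 0 = x) :
    ∫ t : UCircle, ‖1 - Complex.exp (-F.eval (t.toCircle : ℂ))‖ ^ 2 ∂arcMeasure ≤ 2 * x := by
  have hd : Differentiable ℂ fun z => Complex.exp (-F.eval z) :=
    F.differentiable.neg.cexp
  have hc : Continuous fun t : UCircle => Complex.exp (-F.eval (t.toCircle : ℂ)) :=
    hd.continuous.comp continuous_coe_toCircle
  have h1 : ∫ t : UCircle, Complex.exp (-F.eval (t.toCircle : ℂ)) ∂arcMeasure = Complex.exp (-x) := by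
    have := integral_dilate (R := 2) (r := 1) hd.differentiableOn zero_le_one one_lt_two
    simpa only [dilate_one_apply, hx] using this
  have h2 : ∫ t : UCircle, (Complex.exp (-F.eval (t.toCircle : ℂ))).re ∂arcMeasure
      = Real.exp (-x) := by
    rw [← Complex.exp_ofReal_re, Complex.ofReal_neg, ← h1]
    exact integral_re (𝕜 := ℂ) (integrable_of_continuous hc)
  have hcr : Integrable (fun t : UCircle => (Complex.exp (-F.eval (t.toCircle : ℂ))).re)
      arcMeasure := integrable_of_continuous (Complex.continuous_re.comp hc)
  have h3 : ∫ t : UCircle, ‖1 - Complex.exp (-F.eval (t.toCircle : ℂ))‖ ^ 2 ∂arcMeasure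
      ≤ ∫ t : UCircle, (2 - 2 * (Complex.exp (-F.eval (t.toCircle : ℂ))).re) ∂arcMeasure := by
    refine integral_mono (integrable_of_continuous ((continuous_const.sub hc).norm.pow 2))
      ((integrable_const _).sub (hcr.const_mul 2)) fun t => ?_
    have h4 : ‖Complex.exp (-F.eval (t.toCircle : ℂ))‖ ≤ 1 := by
      rw [Complex.norm_exp, Complex.neg_re]
      exact Real.exp_le_one_iff.2 (by linarith [hF t])
    have h5 : ‖Complex.exp (-F.eval (t.toCircle : ℂ))‖ ^ 2 ≤ 1 :=
      pow_le_one₀ (norm_nonneg _) h4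
    simp only [← Complex.normSq_eq_norm_sq, Complex.normSq_apply, Complex.sub_re, Complex.sub_im,
      Complex.one_re, Complex.one_im] at h5 ⊢
    linarith
  rw [integral_sub (integrable_const _) (hcr.const_mul 2), integral_const_mul, integral_const,
    probReal_univ, one_smul, h2] at h3
  linarith [Real.add_one_le_exp (-x)]

/-- For functions bounded by `2`, smallness in `L²` passes to every finite exponent: with `Q =
max(p, 2)`, `|u|^Q ≤ 2^(Q-2) |u|²`. -/
lemma circleNorm_le_of_integral_sq_le {p : ℝ≥0∞} (hp : 1 ≤ p) (hp' : p ≠ ∞) {ε : ℝ} (hε : 0 < ε) :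
    ∃ a > 0, ∀ u : UCircle → ℂ, Continuous u → (∀ t, ‖u t‖ ≤ 2) →
      ∫ t, ‖u t‖ ^ 2 ∂arcMeasure ≤ a → circleNorm p u ≤ ε := by
  set q := max p 2 with hq
  have hq' : q ≠ ∞ := (max_lt hp'.lt_top ENNReal.ofNat_lt_top).ne
  have hQ : 2 ≤ q.toReal := by
    have := ENNReal.toReal_mono hq' (le_max_right p 2)
    simpa using this
  have hQ0 : 0 < q.toReal := by linarith
  have h2 : (0 : ℝ) < 2 ^ (q.toReal - 2) := Real.rpow_pos_of_pos two_pos _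
  refine ⟨ε ^ q.toReal / 2 ^ (q.toReal - 2), div_pos (Real.rpow_pos_of_pos hε _) h2,
    fun u hu hu2 ha => ?_⟩
  refine (circleNorm_mono_exponent (le_max_left p 2) hu).trans ?_
  refine (Real.rpow_le_rpow_iff circleNorm_nonneg hε.le hQ0).1 ?_
  rw [circleNorm_rpow (hp.trans (le_max_left p 2)) hq' hu]
  have h3 : ∫ t, ‖u t‖ ^ q.toReal ∂arcMeasure
      ≤ ∫ t, 2 ^ (q.toReal - 2) * ‖u t‖ ^ 2 ∂arcMeasure := by
    refine integral_mono (integrable_of_continuous (hu.norm.rpow_const fun _ => Or.inr hQ0.le))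
      (integrable_of_continuous (continuous_const.mul (hu.norm.pow 2))) fun t => ?_
    have h4 : ‖u t‖ ^ q.toReal = ‖u t‖ ^ (q.toReal - 2) * ‖u t‖ ^ 2 := by
      rw [← Real.rpow_natCast, ← Real.rpow_add_of_nonneg (norm_nonneg _) (by linarith) (by simp)]
      norm_num
    change ‖u t‖ ^ q.toReal ≤ 2 ^ (q.toReal - 2) * ‖u t‖ ^ 2
    rw [h4]
    exact mul_le_mul_of_nonneg_right
      (Real.rpow_le_rpow (norm_nonneg _) (hu2 t) (by linarith)) (sq_nonneg _)
  rw [integral_const_mul] at h3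
  refine h3.trans ?_
  rwa [← le_div_iff₀' h2]

/-- Polynomials of small norm that are close to `1` on a closed null set. -/
lemma exists_polynomial_near_one {p : ℝ≥0∞} (hp : 1 ≤ p) (hp' : p ≠ ∞) {E : Set UCircle}
    (hE : IsClosed E) (hE0 : arcMeasure E = 0) {ε : ℝ} (hε : 0 < ε) :
    ∃ q : Polynomial ℂ, circleNorm p (dilate (fun z => q.eval z) 1) ≤ ε ∧
      ∀ t ∈ E, ‖q.eval (t.toCircle : ℂ) - 1‖ ≤ ε := by
  obtain ⟨a, ha, hsmall⟩ := circleNorm_le_of_integral_sq_le hp hp' (half_pos hε)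
  obtain ⟨M, hM0, hM⟩ : ∃ M : ℝ, 0 ≤ M ∧ Real.exp (-M) ≤ ε / 2 := by
    refine ⟨max 0 (-Real.log (ε / 2)), le_max_left _ _, ?_⟩
    rw [← Real.le_log_iff_exp_le (half_pos hε)]
    linarith [le_max_right 0 (-Real.log (ε / 2))]
  obtain ⟨F, hF0, hFM, x, hx, hxa⟩ := exists_polynomial_large_re hE hE0 hM0 (half_pos ha)
  -- `ψ` has all the required properties except being a polynomial; it is entire, so a polynomial
  -- approximates it uniformly on the closed disc. Each step uses half of `ε`.
  set ψ : ℂ → ℂ := fun z => 1 - Complex.exp (-F.eval z) with hψ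
  have hd : Differentiable ℂ ψ := (differentiable_const 1).sub F.differentiable.neg.cexp
  obtain ⟨q, hq⟩ := exists_polynomial_near (R := 2) (r := 1) hd.differentiableOn zero_le_one
    one_lt_two (half_pos hε)
  have hc1 := continuous_dilate_of_lt (R := 2) (r := 1) hd.differentiableOn zero_le_one one_lt_two
  have hexp : ∀ t : UCircle, ‖Complex.exp (-F.eval (t.toCircle : ℂ))‖
      = Real.exp (-(F.eval (t.toCircle : ℂ)).re) := fun t => by
    rw [Complex.norm_exp, Complex.neg_re]
  have hψn : circleNorm p (dilate ψ 1) ≤ ε / 2 := by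
    refine hsmall _ hc1 (fun t => ?_) ?_
    · rw [dilate_one_apply]
      refine (norm_sub_le _ _).trans ?_
      rw [hexp, norm_one]
      linarith [Real.exp_le_one_iff.2 (show -(F.eval (t.toCircle : ℂ)).re ≤ 0 by linarith [hF0 t])]
    · simp only [dilate_one_apply]
      exact (integral_normSq_one_sub_exp_neg_le hF0 hx).trans (by linarith)
  refine ⟨q, ?_, fun t ht => ?_⟩
  · have h1 : circleNorm p (dilate (fun z => q.eval z) 1 - dilate ψ 1) ≤ ε / 2 := by
      rw [circleNorm_sub_comm]
      exact circleNorm_le_of_bound (half_pos hε).le fun t =>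
        (hq _ (by rw [norm_mul_toCircle zero_le_one])).le
    have h2 := circleNorm_add_le hp ((continuous_dilate_eval q 1).sub hc1) hc1
    rw [sub_add_cancel] at h2
    linarith
  · have h1 := hq (t.toCircle : ℂ) (Circle.norm_coe _).le
    have h2 : q.eval (t.toCircle : ℂ) - 1
        = -(ψ t.toCircle - q.eval (t.toCircle : ℂ)) - Complex.exp (-F.eval (t.toCircle : ℂ)) := by
      rw [hψ]
      ring
    rw [h2]
    refine (norm_sub_le _ _).trans ?_
    rw [norm_neg, hexp]
    have h3 := Real.exp_le_exp.2 (neg_le_neg (hFM t ht))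
    linarith

/-- The continuous functions that are approximable on `E` by polynomials of small norm. -/
def smallApproximable (p : ℝ≥0∞) [hp : Fact (1 ≤ p)] (E : Set UCircle) :
    Submodule ℂ C(UCircle, ℂ) where
  carrier := {g | ∀ ε > 0, ∃ q : Polynomial ℂ, circleNorm p (dilate (fun z => q.eval z) 1) ≤ ε ∧
    ∀ t ∈ E, ‖q.eval (t.toCircle : ℂ) - g t‖ ≤ ε}
  zero_mem' := fun ε hε => ⟨0, circleNorm_le_of_bound hε.le fun t => by simpa [dilate] using hε.le,
    fun t _ => by simpa using hε.le⟩
  add_mem' := fun {g h} hg hh ε hε => by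
    obtain ⟨q, hq, hq'⟩ := hg _ (half_pos hε)
    obtain ⟨r, hr, hr'⟩ := hh _ (half_pos hε)
    refine ⟨q + r, ?_, fun t ht => ?_⟩
    · have h1 : dilate (fun z => (q + r).eval z) 1
          = dilate (fun z => q.eval z) 1 + dilate (fun z => r.eval z) 1 :=
        funext fun t => Polynomial.eval_add
      rw [h1]
      exact (circleNorm_add_le hp.out (continuous_dilate_eval q 1)
        (continuous_dilate_eval r 1)).trans (by linarith)
    · rw [Polynomial.eval_add, ContinuousMap.add_apply, add_sub_add_comm]
      exact (norm_add_le _ _).trans (by linarith [hq' t ht, hr' t ht])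
  smul_mem' := fun c g hg ε hε => by
    have hc : 0 < ‖c‖ + 1 := by positivity
    obtain ⟨q, hq, hq'⟩ := hg (ε / (‖c‖ + 1)) (by positivity)
    have hcε : ‖c‖ * (ε / (‖c‖ + 1)) ≤ ε := by
      rw [mul_div_assoc', div_le_iff₀ hc]
      nlinarith
    refine ⟨c • q, ?_, fun t ht => ?_⟩
    · have h1 : dilate (fun z => (c • q).eval z) 1 = c • dilate (fun z => q.eval z) 1 :=
        funext fun t => Polynomial.eval_smul c q _
      rw [h1, circleNorm_const_smul]
      exact (mul_le_mul_of_nonneg_left hq (norm_nonneg c)).trans hcε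
    · rw [Polynomial.eval_smul, ContinuousMap.smul_apply, ← smul_sub, norm_smul]
      exact (mul_le_mul_of_nonneg_left (hq' t ht) (norm_nonneg c)).trans hcε

section smallApproximable

variable {p : ℝ≥0∞} [hp : Fact (1 ≤ p)] {E : Set UCircle}

lemma isClosed_smallApproximable : IsClosed (smallApproximable p E : Set C(UCircle, ℂ)) := by
  refine isClosed_of_closure_subset fun g hg ε hε => ?_
  obtain ⟨h, hh, hgh⟩ := Metric.mem_closure_iff.1 hg _ (half_pos hε)
  obtain ⟨q, hq, hq'⟩ := hh _ (half_pos hε)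
  refine ⟨q, hq.trans (by linarith), fun t ht => ?_⟩
  rw [dist_comm, ContinuousMap.dist_lt_iff (half_pos hε)] at hgh
  rw [← sub_add_sub_cancel _ (h t)]
  refine (norm_add_le _ _).trans ?_
  have := hgh t
  rw [dist_eq_norm] at this
  linarith [hq' t ht]

lemma fourier_add_one_mem {n : ℤ} (h : fourier n ∈ smallApproximable p E) :
    fourier (n + 1) ∈ smallApproximable p E := by
  intro ε hε
  obtain ⟨q, hq, hq'⟩ := h ε hε
  refine ⟨q * Polynomial.X, (circleNorm_mono (continuous_dilate_eval q 1) fun t => ?_).trans hq,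
    fun t ht => ?_⟩
  · rw [dilate_one_apply, dilate_one_apply, Polynomial.eval_mul_X, norm_mul, Circle.norm_coe,
      mul_one]
  · rw [Polynomial.eval_mul_X, fourier_add, fourier_one, ← sub_mul, norm_mul, Circle.norm_coe,
      mul_one]
    exact hq' t ht

lemma norm_coeff_zero_le (q : Polynomial ℂ) :
    ‖q.coeff 0‖ ≤ circleNorm p (dilate (fun z => q.eval z) 1) := by
  have h1 := integral_dilate (f := fun z => q.eval z) (R := 2) (r := 1)
    q.differentiable.differentiableOn zero_le_one one_lt_two
  rw [Polynomial.coeff_zero_eq_eval_zero, ← h1]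
  refine (norm_integral_le_integral_norm _).trans ?_
  rw [← circleNorm_one (continuous_dilate_eval q 1)]
  exact circleNorm_mono_exponent hp.out (continuous_dilate_eval q 1)

/-- Dividing by `z` requires removing the constant term first. That term is a mean over the circle,
so it is bounded by the norm and costs at most a factor `2`. -/
lemma fourier_sub_one_mem {n : ℤ} (h : fourier n ∈ smallApproximable p E) :
    fourier (n - 1) ∈ smallApproximable p E := by
  intro ε hε
  obtain ⟨q, hq, hq'⟩ := h _ (half_pos hε)
  have h0 := (norm_coeff_zero_le (p := p) q).trans hq
  have hX : ∀ t : UCircle,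
      q.divX.eval (t.toCircle : ℂ) * (t.toCircle : ℂ) = q.eval (t.toCircle : ℂ) - q.coeff 0 := by
    intro t
    conv_rhs => rw [← q.divX_mul_X_add]
    simp
  refine ⟨q.divX, ?_, fun t ht => ?_⟩
  · have h1 : circleNorm p (dilate (fun z => q.divX.eval z) 1)
        ≤ circleNorm p (dilate (fun z => q.eval z) 1 - fun _ => q.coeff 0) := by
      refine circleNorm_mono ((continuous_dilate_eval q 1).sub continuous_const) fun t => ?_
      rw [Pi.sub_apply, dilate_one_apply, dilate_one_apply, ← hX, norm_mul, Circle.norm_coe,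
        mul_one]
    have h2 := circleNorm_sub_le hp.out (continuous_dilate_eval q 1)
      (continuous_const (y := q.coeff 0))
    have h3 : circleNorm p (fun _ : UCircle => q.coeff 0) ≤ ‖q.coeff 0‖ :=
      circleNorm_le_of_bound (norm_nonneg _) fun _ => le_rfl
    linarith
  · have h1 : fourier n t = fourier (n - 1) t * (t.toCircle : ℂ) := by
      rw [← fourier_one, ← fourier_add, sub_add_cancel]
    have h2 : ‖q.divX.eval (t.toCircle : ℂ) - fourier (n - 1) t‖
        = ‖(q.eval (t.toCircle : ℂ) - fourier n t) - q.coeff 0‖ := by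
      rw [sub_right_comm, ← hX, h1, ← sub_mul, norm_mul, Circle.norm_coe, mul_one]
    rw [h2]
    exact (norm_sub_le _ _).trans (by linarith [hq' t ht])

lemma smallApproximable_eq_top (hp' : p ≠ ∞) (hE : IsClosed E) (hE0 : arcMeasure E = 0) :
    smallApproximable p E = ⊤ := by
  have h0 : fourier 0 ∈ smallApproximable p E := by
    intro ε hε
    simpa only [fourier_zero] using exists_polynomial_near_one hp.out hp' hE hE0 hε
  have hn : ∀ n : ℤ, fourier n ∈ smallApproximable p E := fun n => by
    induction n using Int.induction_on with
    | zero => exact h0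
    | succ n ih => exact fourier_add_one_mem ih
    | pred n ih => exact fourier_sub_one_mem ih
  rw [eq_top_iff, ← span_fourier_closure_eq_top (T := 2 * Real.pi)]
  refine Submodule.topologicalClosure_minimal _ (Submodule.span_le.2 ?_) isClosed_smallApproximable
  rintro _ ⟨n, rfl⟩
  exact hn n

/-- Every continuous function on a closed null set is uniformly approximable by polynomials of
arbitrarily small norm. -/
lemma exists_polynomial_near_of_null (hp' : p ≠ ∞) (hE : IsClosed E) (hE0 : arcMeasure E = 0)
    (g : C(E, ℂ)) {ε : ℝ} (hε : 0 < ε) :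
    ∃ q : Polynomial ℂ, circleNorm p (dilate (fun z => q.eval z) 1) ≤ ε ∧
      ∀ t : E, ‖q.eval ((t : UCircle).toCircle : ℂ) - g t‖ ≤ ε := by
  obtain ⟨G, rfl⟩ := ContinuousMap.exists_restrict_eq hE g
  have hG : G ∈ smallApproximable p E := by
    rw [smallApproximable_eq_top hp' hE hE0]
    trivial
  obtain ⟨q, hq, hq'⟩ := hG ε hε
  exact ⟨q, hq, fun t => hq' t t.2⟩

end smallApproximable

/-! ### Residuality -/

/-- The Baire argument common to both spaces. Density is asked with the approximation valid for all
large `n`, so that an index in `Λ` can be chosen afterwards. -/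
lemma eventually_residual_hasAllUniformLimits {X : Type*} [TopologicalSpace X]
    {S : X → ℕ → UCircle → ℂ} {E : Set UCircle} (hE : IsClosed E) {Λ : Set ℕ} (hΛ : Λ.Infinite)
    (hcont : ∀ n f₀, ∀ ε > 0, ∀ᶠ f in 𝓝 f₀, ∀ t, ‖S f n t - S f₀ n t‖ < ε)
    (hdense : ∀ f₀, ∀ V ∈ 𝓝 f₀, ∀ g : C(E, ℂ), ∀ ε > 0, ∃ f ∈ V, ∃ N, ∀ n ≥ N, ∀ t : E,
      ‖S f n t - g t‖ ≤ ε) :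
    ∀ᶠ f in residual X, HasAllUniformLimits E Λ (S f) := by
  have : CompactSpace E := isCompact_iff_compactSpace.1 hE.isCompact
  let d := TopologicalSpace.denseSeq C(E, ℂ)
  -- The intermediate bound `c` expresses that the supremum over `E` is strictly below the
  -- tolerance, which makes the set open.
  let U : ℕ → ℕ → ℕ → Set X := fun j k m => {f | ∃ n ∈ Λ, m ≤ n ∧ ∃ c < 1 / ((k : ℝ) + 1),
    ∀ t : E, ‖S f n t - d j t‖ ≤ c}
  have hUo : ∀ j k m, IsOpen (U j k m) := by
    intro j k m
    refine isOpen_iff_mem_nhds.2 fun f₀ ⟨n, hn, hmn, c, hc, h⟩ => ?_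
    obtain ⟨c', hcc', hc'⟩ := exists_between hc
    filter_upwards [hcont n f₀ (c' - c) (sub_pos.2 hcc')] with f hf
    refine ⟨n, hn, hmn, c', hc', fun t => ?_⟩
    rw [← sub_add_sub_cancel _ (S f₀ n t)]
    refine (norm_add_le _ _).trans ?_
    linarith [hf t, h t]
  have hUd : ∀ j k m, Dense (U j k m) := by
    intro j k m f₀
    refine mem_closure_iff_nhds.2 fun V hV => ?_
    have hk : (0 : ℝ) < 1 / ((k : ℝ) + 1) := Nat.one_div_pos_of_nat
    obtain ⟨f, hf, N, hN⟩ := hdense f₀ V hV (d j) _ (half_pos hk)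
    obtain ⟨n, hn, hnN⟩ := hΛ.exists_gt (max m N)
    exact ⟨f, hf, n, hn, (le_max_left _ _).trans hnN.le, _, half_lt_self hk,
      hN n ((le_max_right _ _).trans hnN.le)⟩
  have hres : ∀ᶠ f in residual X, ∀ j k m, f ∈ U j k m :=
    eventually_countable_forall.2 fun j => eventually_countable_forall.2 fun k =>
      eventually_countable_forall.2 fun m => residual_of_dense_open (hUo j k m) (hUd j k m)
  filter_upwards [hres] with f hf g
  have hfreq : ∀ k : ℕ, ∃ᶠ n in atTop, n ∈ Λ ∧ ∀ t : E, ‖S f n t - g t‖ < 1 / ((k : ℝ) + 1) := by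
    intro k
    have hk : (0 : ℝ) < 1 / ((k : ℝ) + 1) := Nat.one_div_pos_of_nat
    obtain ⟨i, hi⟩ := exists_nat_one_div_lt (half_pos hk)
    obtain ⟨j, hj⟩ := Metric.denseRange_iff.1 (TopologicalSpace.denseRange_denseSeq C(E, ℂ)) g _
      (half_pos hk)
    refine frequently_atTop.2 fun m => ?_
    obtain ⟨n, hn, hmn, c, hc, h⟩ := hf j i m
    refine ⟨n, hmn, hn, fun t => ?_⟩
    rw [dist_comm, ContinuousMap.dist_lt_iff (half_pos hk)] at hj
    have h1 := hj t
    rw [dist_eq_norm] at h1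
    rw [← sub_add_sub_cancel _ (d j t)]
    refine (norm_add_le _ _).trans_lt ?_
    linarith [h t]
  obtain ⟨φ, hφ, h⟩ := extraction_forall_of_frequently hfreq
  refine ⟨φ, hφ, fun k => (h k).1, Metric.tendstoUniformly_iff.2 fun ε hε => ?_⟩
  have := (tendsto_one_div_add_atTop_nhds_zero_nat (𝕜 := ℝ)).eventually_lt_const hε
  filter_upwards [this] with k hk t
  rw [dist_comm, dist_eq_norm]
  exact ((h k).2 t).trans hk

/-! ### The Hardy space -/

/-- Cauchy's estimate on the circle of radius `1/2`. The growth in `n` is harmless, since only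
continuity of each fixed partial sum is needed. -/
lemma norm_iteratedDeriv_div_factorial_le {f : ℂ → ℂ}
    (hf : DifferentiableOn ℂ f (Metric.ball 0 1)) (n : ℕ) :
    ‖iteratedDeriv n f 0 / (n.factorial : ℂ)‖ ≤ 2 ^ n * circleNorm 1 (dilate f (1 / 2)) := by
  have hs := (hf.mono (Metric.closedBall_subset_ball
    (by norm_num : ((1 / 2 : NNReal) : ℝ) < 1))).hasFPowerSeriesOnBall (by norm_num)
  have h1 := hs.factorial_smul 1 n
  rw [← iteratedDeriv_eq_iteratedFDeriv, nsmul_eq_mul] at h1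
  rw [← h1, mul_div_cancel_left₀ _ (Nat.cast_ne_zero.2 n.factorial_ne_zero)]
  refine ((cauchyPowerSeries f 0 ((1 / 2 : NNReal) : ℝ) n).le_opNorm _).trans ?_
  simp only [norm_one, Finset.prod_const_one, mul_one]
  refine (norm_cauchyPowerSeries_le _ _ _ _).trans_eq ?_
  have h2 := circleAverage_eq_integral (fun z => ‖f z‖) (1 / 2)
  rw [Real.circleAverage_def, smul_eq_mul] at h2
  have h3 : ((1 / 2 : NNReal) : ℝ) = 1 / 2 := by norm_num
  rw [h3, h2, circleNorm_one (continuous_dilate_of_lt hf (by norm_num) (by norm_num)), mul_comm]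
  congr 1
  rw [abs_of_pos (by norm_num), one_div, inv_inv]

lemma iteratedDeriv_eval_zero (q : Polynomial ℂ) (n : ℕ) :
    iteratedDeriv n (fun z => q.eval z) 0 = n.factorial * q.coeff n := by
  have h : ∀ k, iteratedDeriv k (fun z => q.eval z)
      = fun z => (Polynomial.derivative^[k] q).eval z := by
    intro k
    induction k with
    | zero => simp
    | succ k ih =>
      rw [iteratedDeriv_succ, ih, Function.iterate_succ_apply']
      exact funext fun z => Polynomial.deriv _
  rw [h]
  change Polynomial.eval 0 _ = _
  rw [← Polynomial.coeff_zero_eq_eval_zero, Polynomial.coeff_iterate_derivative, zero_add,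
    Nat.descFactorial_self, nsmul_eq_mul]

lemma taylorSum_eq_eval {f : ℂ → ℂ} {q : Polynomial ℂ} (h : f =ᶠ[𝓝 0] fun z => q.eval z) {n : ℕ}
    (hn : q.natDegree ≤ n) (z : ℂ) : taylorSum f n z = q.eval z := by
  rw [taylorSum, Polynomial.eval_eq_sum_range' (Nat.lt_succ_of_le hn)]
  refine Finset.sum_congr rfl fun k _ => ?_
  rw [h.iteratedDeriv_eq, iteratedDeriv_eval_zero,
    mul_div_cancel_left₀ _ (Nat.cast_ne_zero.2 k.factorial_ne_zero)]

namespace HardySpace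

lemma hardyENorm_le_ofReal {p : ℝ≥0∞} {f : ℂ → ℂ} (hf : DifferentiableOn ℂ f (Metric.ball 0 1)) {C : ℝ}
    (h : ∀ r ∈ Ioo (0 : ℝ) 1, circleNorm p (dilate f r) ≤ C) :
    hardyENorm p f ≤ ENNReal.ofReal C :=
  iSup₂_le fun r hr => by
    rw [eLpNorm_eq_ofReal_circleNorm (continuous_dilate hf hr)]
    exact ENNReal.ofReal_le_ofReal (h r hr)

variable {p : ℝ≥0∞} [hp : Fact (1 ≤ p)]

lemma differentiableOn (f : HardySpace p) : DifferentiableOn ℂ f (Metric.ball 0 1) := f.2.1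

lemma sub_eq (f g : HardySpace p) : ((f - g : HardySpace p) : ℂ → ℂ) = (f : ℂ → ℂ) - (g : ℂ → ℂ) :=
  rfl

lemma circleNorm_dilate_le (f : HardySpace p) {r : ℝ} (hr : r ∈ Ioo (0 : ℝ) 1) :
    circleNorm p (dilate f r) ≤ ‖f‖ :=
  ENNReal.toReal_mono f.2.2.2.ne (le_iSup₂ (f := fun r (_ : r ∈ Ioo (0 : ℝ) 1) =>
    eLpNorm (dilate f r) p arcMeasure) r hr)

lemma norm_le_of_forall {f : HardySpace p} {C : ℝ} (hC : 0 ≤ C)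
    (h : ∀ r ∈ Ioo (0 : ℝ) 1, circleNorm p (dilate f r) ≤ C) : ‖f‖ ≤ C :=
  ENNReal.toReal_le_of_le_ofReal hC (hardyENorm_le_ofReal f.differentiableOn h)

lemma eqOn_indicator (q : Polynomial ℂ) :
    EqOn ((Metric.ball (0 : ℂ) 1).indicator fun z => q.eval z) (fun z => q.eval z)
      (Metric.ball 0 1) :=
  fun _ hz => indicator_of_mem hz _

lemma dilate_indicator (q : Polynomial ℂ) {r : ℝ} (hr : r ∈ Ioo (0 : ℝ) 1) :
    dilate ((Metric.ball (0 : ℂ) 1).indicator fun z => q.eval z) r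
      = dilate (fun z => q.eval z) r :=
  funext fun t => eqOn_indicator q (mul_toCircle_mem_ball hr t)

/-- A polynomial as an element of the Hardy space. -/
def ofPolynomial (p : ℝ≥0∞) [hp : Fact (1 ≤ p)] (q : Polynomial ℂ) : HardySpace p :=
  have hd : DifferentiableOn ℂ ((Metric.ball (0 : ℂ) 1).indicator fun z => q.eval z)
      (Metric.ball 0 1) := q.differentiable.differentiableOn.congr (eqOn_indicator q)
  ⟨(Metric.ball (0 : ℂ) 1).indicator fun z => q.eval z, hd,
    fun _ hz => indicator_of_notMem hz _,
    (hardyENorm_le_ofReal hd fun r hr => by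
      rw [dilate_indicator q hr]
      exact circleNorm_dilate_eval_mono q hr.1.le hr.2.le).trans_lt ENNReal.ofReal_lt_top⟩

lemma dilate_ofPolynomial (q : Polynomial ℂ) {r : ℝ} (hr : r ∈ Ioo (0 : ℝ) 1) :
    dilate (ofPolynomial p q) r = dilate (fun z => q.eval z) r :=
  dilate_indicator q hr

lemma taylorSum_ofPolynomial (q : Polynomial ℂ) {n : ℕ} (hn : q.natDegree ≤ n) (z : ℂ) :
    taylorSum (ofPolynomial p q) n z = q.eval z :=
  taylorSum_eq_eval ((eqOn_indicator q).eventuallyEq_of_mem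
    (Metric.ball_mem_nhds 0 zero_lt_one)) hn z

lemma taylorSum_sub (f g : HardySpace p) (n : ℕ) (z : ℂ) :
    taylorSum f n z - taylorSum g n z = taylorSum (f - g : HardySpace p) n z := by
  have hc : ∀ (h : HardySpace p) (k : ℕ), ContDiffAt ℂ k h 0 := fun h k =>
    (h.differentiableOn.contDiffOn Metric.isOpen_ball).contDiffAt
      (Metric.ball_mem_nhds 0 zero_lt_one)
  rw [taylorSum, taylorSum, taylorSum, ← Finset.sum_sub_distrib]
  refine Finset.sum_congr rfl fun k _ => ?_
  rw [sub_eq, iteratedDeriv_sub (hc f k) (hc g k)]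
  ring

lemma norm_taylorSum_le (f : HardySpace p) (n : ℕ) {z : ℂ} (hz : ‖z‖ = 1) :
    ‖taylorSum f n z‖ ≤ (∑ k ∈ Finset.range (n + 1), 2 ^ k) * ‖f‖ := by
  rw [Finset.sum_mul]
  refine norm_sum_le_of_le _ fun k _ => ?_
  rw [norm_mul, norm_pow, hz, one_pow, mul_one]
  refine (norm_iteratedDeriv_div_factorial_le f.differentiableOn k).trans ?_
  refine mul_le_mul_of_nonneg_left ?_ (by positivity)
  have hr : (1 / 2 : ℝ) ∈ Ioo (0 : ℝ) 1 := ⟨by norm_num, by norm_num⟩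
  exact (circleNorm_mono_exponent hp.out (continuous_dilate f.differentiableOn hr)).trans
    (f.circleNorm_dilate_le hr)

lemma eventually_norm_taylorSum_sub_lt (n : ℕ) (f₀ : HardySpace p) {ε : ℝ} (hε : 0 < ε) :
    ∀ᶠ f : HardySpace p in 𝓝 f₀, ∀ t : UCircle,
      ‖taylorSum f n (t.toCircle : ℂ) - taylorSum f₀ n (t.toCircle : ℂ)‖ < ε := by
  set K : ℝ := ∑ k ∈ Finset.range (n + 1), 2 ^ k with hK
  have hlim : Tendsto (fun f : HardySpace p => K * ‖f - f₀‖) (𝓝 f₀) (𝓝 0) := by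
    have : Continuous fun f : HardySpace p => K * ‖f - f₀‖ := by fun_prop
    simpa using this.tendsto f₀
  filter_upwards [hlim.eventually_lt_const hε] with f hf t
  rw [taylorSum_sub]
  exact (norm_taylorSum_le (f - f₀) n (Circle.norm_coe _)).trans_lt hf

/-- Take `f = q₀ + q` with `q₀` near `f₀` in norm, and `q` of small norm and close to `g - q₀` on
`E`. Beyond the degree, the partial sums are `f` itself. -/
lemma exists_near_taylorSum_near (hp' : p ≠ ∞) {E : Set UCircle} (hE : IsClosed E)
    (hE0 : arcMeasure E = 0) (f₀ : HardySpace p) (g : C(E, ℂ)) {δ ε : ℝ} (hδ : 0 < δ)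
    (hε : 0 < ε) : ∃ f : HardySpace p, ‖f - f₀‖ ≤ δ ∧ ∃ N, ∀ n ≥ N, ∀ t : E,
      ‖taylorSum f n ((t : UCircle).toCircle : ℂ) - g t‖ ≤ ε := by
  obtain ⟨q₀, hq₀⟩ := exists_polynomial_circleNorm_sub_le hp' f₀.differentiableOn
    (fun r hr => f₀.circleNorm_dilate_le hr) (half_pos hδ)
  let w : C(E, ℂ) := ⟨fun t => q₀.eval ((t : UCircle).toCircle : ℂ),
    q₀.continuous.comp (continuous_coe_toCircle.comp continuous_subtype_val)⟩
  obtain ⟨q, hq, hqE⟩ := exists_polynomial_near_of_null hp' hE hE0 (g - w)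
    (lt_min hε (half_pos hδ))
  refine ⟨ofPolynomial p (q₀ + q), norm_le_of_forall hδ.le fun r hr => ?_,
    (q₀ + q).natDegree, fun n hn t => ?_⟩
  · have cf := continuous_dilate f₀.differentiableOn hr
    have c0 := continuous_dilate_eval q₀ r
    have cq := continuous_dilate_eval q r
    have h1 : dilate (ofPolynomial p (q₀ + q) - f₀ : HardySpace p) r
        = (dilate (fun z => q₀.eval z) r - dilate f₀ r) + dilate (fun z => q.eval z) r := by
      have h2 : dilate (ofPolynomial p (q₀ + q) - f₀ : HardySpace p) r
          = dilate (ofPolynomial p (q₀ + q)) r - dilate f₀ r := rfl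
      rw [h2, dilate_ofPolynomial _ hr, sub_add_eq_add_sub]
      congr 1
      exact funext fun t => Polynomial.eval_add
    rw [h1]
    refine (circleNorm_add_le hp.out (c0.sub cf) cq).trans ?_
    rw [circleNorm_sub_comm]
    linarith [hq₀ r hr, circleNorm_dilate_eval_mono (p := p) q hr.1.le hr.2.le,
      min_le_right ε (δ / 2)]
  · rw [taylorSum_ofPolynomial _ hn, Polynomial.eval_add]
    refine le_trans (le_of_eq ?_) ((hqE t).trans (min_le_left _ _))
    congr 1
    change _ = _ - (g t - q₀.eval ((t : UCircle).toCircle : ℂ))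
    ring

end HardySpace

/-! ### The space `L^p` of the circle -/

section Lp

variable {p : ℝ≥0∞} [hp : Fact (1 ≤ p)]

lemma integrable_coe_Lp (f : Lp ℂ p arcMeasure) : Integrable f arcMeasure :=
  (Lp.memLp f).integrable hp.out

lemma norm_fourierCoeff_sub_le (f g : Lp ℂ p arcMeasure) (n : ℤ) :
    ‖fourierCoeff f n - fourierCoeff g n‖ ≤ ‖f - g‖ := by
  have hi : ∀ h : Lp ℂ p arcMeasure, Integrable (fun t => fourier (-n) t • h t) arcMeasure :=
    fun h => (integrable_coe_Lp h).fourier_smul (-n)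
  rw [fourierCoeff, fourierCoeff, ← integral_sub (hi f) (hi g)]
  refine (norm_integral_le_lintegral_norm _).trans ?_
  rw [Lp.norm_def]
  refine ENNReal.toReal_mono (Lp.eLpNorm_ne_top _) ?_
  refine le_trans (le_of_eq ?_) (eLpNorm_le_eLpNorm_of_exponent_le hp.out
    (Lp.aestronglyMeasurable (f - g)))
  rw [eLpNorm_one_eq_lintegral_enorm]
  refine lintegral_congr_ae ?_
  filter_upwards [Lp.coeFn_sub f g] with t ht
  rw [ht, ofReal_norm, ← smul_sub, enorm_smul, Pi.sub_apply, fourier_eq_zpow, ← ofReal_norm,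
    norm_zpow, Circle.norm_coe, one_zpow, ENNReal.ofReal_one, one_mul]

lemma norm_fourierSum_sub_le (f g : Lp ℂ p arcMeasure) (n : ℕ) (t : UCircle) :
    ‖fourierSum f n t - fourierSum g n t‖ ≤ (Finset.Icc (-(n : ℤ)) n).card * ‖f - g‖ := by
  rw [fourierSum, fourierSum, ← Finset.sum_sub_distrib, ← nsmul_eq_mul, ← Finset.sum_const]
  refine norm_sum_le_of_le _ fun k _ => ?_
  rw [← sub_mul, norm_mul, norm_zpow, Circle.norm_coe, one_zpow, mul_one]
  exact norm_fourierCoeff_sub_le f g k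

lemma eventually_norm_fourierSum_sub_lt (n : ℕ) (f₀ : Lp ℂ p arcMeasure) {ε : ℝ} (hε : 0 < ε) :
    ∀ᶠ f in 𝓝 f₀, ∀ t : UCircle,
      ‖fourierSum (f : Lp ℂ p arcMeasure) n t - fourierSum f₀ n t‖ < ε := by
  have hlim : Tendsto (fun f : Lp ℂ p arcMeasure =>
      ((Finset.Icc (-(n : ℤ)) n).card : ℝ) * ‖f - f₀‖) (𝓝 f₀) (𝓝 0) := by
    have : Continuous fun f : Lp ℂ p arcMeasure =>
      ((Finset.Icc (-(n : ℤ)) n).card : ℝ) * ‖f - f₀‖ := by fun_prop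
    simpa using this.tendsto f₀
  filter_upwards [hlim.eventually_lt_const hε] with f hf t
  exact (norm_fourierSum_sub_le f f₀ n t).trans_lt hf

/-- The Fourier partial sums of a trigonometric polynomial are eventually equal to it. -/
lemma exists_fourierSum_eq {w : C(UCircle, ℂ)}
    (hw : w ∈ Submodule.span ℂ (range (fourier (T := 2 * Real.pi)))) :
    ∃ N, ∀ n ≥ N, ∀ t, fourierSum w n t = w t := by
  induction hw using Submodule.span_induction with
  | mem x hx =>
    obtain ⟨k, rfl⟩ := hx
    refine ⟨k.natAbs, fun n hn t => ?_⟩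
    rw [fourierSum, Finset.sum_eq_single_of_mem k (Finset.mem_Icc.2 (by omega)) fun l _ hl => ?_]
    · rw [fourierCoeff_fourier, Pi.single_eq_same, one_mul, fourier_eq_zpow]
    · rw [fourierCoeff_fourier, Pi.single_eq_of_ne hl, zero_mul]
  | zero =>
    refine ⟨0, fun n _ t => ?_⟩
    simp [fourierSum, fourierCoeff]
  | add x y _ _ hx hy =>
    obtain ⟨N, hN⟩ := hx
    obtain ⟨M, hM⟩ := hy
    refine ⟨max N M, fun n hn t => ?_⟩
    rw [ContinuousMap.add_apply, ← hN n ((le_max_left _ _).trans hn),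
      ← hM n ((le_max_right _ _).trans hn), fourierSum, fourierSum, fourierSum,
      ← Finset.sum_add_distrib]
    refine Finset.sum_congr rfl fun k _ => ?_
    rw [ContinuousMap.coe_add, fourierCoeff.add (integrable_of_continuous x.continuous)
      (integrable_of_continuous y.continuous), Pi.add_apply, add_mul]
  | smul a x _ hx =>
    obtain ⟨N, hN⟩ := hx
    refine ⟨N, fun n hn t => ?_⟩
    rw [ContinuousMap.smul_apply, ← hN n hn, fourierSum, fourierSum, Finset.smul_sum]
    refine Finset.sum_congr rfl fun k _ => ?_
    rw [ContinuousMap.coe_smul]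
    have := fourierCoeff.const_smul (⇑x) a k
    rw [this, smul_eq_mul, smul_eq_mul, mul_assoc]

lemma fourierSum_toLp (w : C(UCircle, ℂ)) (n : ℕ) (t : UCircle) :
    fourierSum (ContinuousMap.toLp p arcMeasure ℂ w) n t = fourierSum w n t := by
  rw [fourierSum, fourierSum]
  refine Finset.sum_congr rfl fun k _ => ?_
  rw [fourierCoeff_congr_ae (ContinuousMap.coeFn_toLp arcMeasure w)]

lemma rotated_mem_span (q : Polynomial ℂ) (w : ℂ) :
    rotated q w ∈ Submodule.span ℂ (range (fourier (T := 2 * Real.pi))) :=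
  Submodule.sum_mem _ fun k _ => Submodule.smul_mem _ _ (Submodule.subset_span ⟨k, rfl⟩)

lemma norm_toLp_rotated_one (q : Polynomial ℂ) :
    ‖ContinuousMap.toLp p arcMeasure ℂ (rotated q 1)‖
      = circleNorm p (dilate (fun z => q.eval z) 1) := by
  rw [Lp.norm_def, circleNorm, eLpNorm_congr_ae (ContinuousMap.coeFn_toLp arcMeasure _)]
  congr 2
  exact funext fun t => by rw [rotated_apply, one_mul, dilate_one_apply]

lemma exists_toLp_near (hp' : p ≠ ∞) (f : Lp ℂ p arcMeasure) {δ : ℝ} (hδ : 0 < δ) :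
    ∃ w ∈ Submodule.span ℂ (range (fourier (T := 2 * Real.pi))),
      ‖ContinuousMap.toLp p arcMeasure ℂ w - f‖ < δ := by
  have hf : f ∈ (Submodule.span ℂ (range (fourierLp (T := 2 * Real.pi) p))).topologicalClosure := by
    rw [span_fourierLp_closure_eq_top hp']
    trivial
  obtain ⟨v, hv, hvf⟩ := Metric.mem_closure_iff.1 hf δ hδ
  have hr : range (fourierLp (T := 2 * Real.pi) p)
      = (ContinuousMap.toLp (E := ℂ) p arcMeasure ℂ).toLinearMap ''
        range (fourier (T := 2 * Real.pi)) := by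
    rw [← range_comp]
    rfl
  rw [hr, SetLike.mem_coe, Submodule.span_image] at hv
  obtain ⟨w, hw, rfl⟩ := hv
  rw [dist_comm, dist_eq_norm] at hvf
  exact ⟨w, hw, hvf⟩

/-- The same construction with a trigonometric polynomial `w` near `f₀`. The correction can still be
an analytic polynomial, entering as `rotated q 1`. -/
lemma exists_near_fourierSum_near (hp' : p ≠ ∞) {E : Set UCircle} (hE : IsClosed E)
    (hE0 : arcMeasure E = 0) (f₀ : Lp ℂ p arcMeasure) (g : C(E, ℂ)) {δ ε : ℝ} (hδ : 0 < δ)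
    (hε : 0 < ε) : ∃ f : Lp ℂ p arcMeasure, ‖f - f₀‖ < δ ∧ ∃ N, ∀ n ≥ N, ∀ t : E,
      ‖fourierSum f n t - g t‖ ≤ ε := by
  obtain ⟨w, hw, hwf⟩ := exists_toLp_near hp' f₀ (half_pos hδ)
  obtain ⟨q, hq, hqE⟩ := exists_polynomial_near_of_null hp' hE hE0 (g - w.restrict E)
    (lt_min hε (half_pos hδ))
  obtain ⟨N, hN⟩ := exists_fourierSum_eq (Submodule.add_mem _ hw (rotated_mem_span q 1))
  refine ⟨ContinuousMap.toLp p arcMeasure ℂ (w + rotated q 1), ?_, N, fun n hn t => ?_⟩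
  · rw [map_add, add_sub_right_comm]
    refine (norm_add_le _ _).trans_lt ?_
    rw [norm_toLp_rotated_one]
    linarith [min_le_right ε (δ / 2)]
  · rw [fourierSum_toLp, hN n hn]
    refine le_trans (le_of_eq ?_) ((hqE t).trans (min_le_left _ _))
    congr 1
    rw [ContinuousMap.add_apply, rotated_apply, one_mul, ContinuousMap.sub_apply,
      ContinuousMap.restrict_apply]
    ring

end Lp

end

theorem theorem1 (p : ℝ≥0∞) [Fact (1 ≤ p)] (hp : p ≠ ∞)
    (E : Set UCircle) (hE : IsClosed E) (hE0 : arcMeasure E = 0)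
    (Λ : Set ℕ) (hΛ : Λ.Infinite) :
    (∀ᶠ f : HardySpace p in residual (HardySpace p),
      HasAllUniformLimits E Λ (fun n t => taylorSum f n (t.toCircle : ℂ))) ∧
    (∀ᶠ f : Lp ℂ p arcMeasure in residual (Lp ℂ p arcMeasure),
      HasAllUniformLimits E Λ (fun n t => fourierSum f n t)) := by
  refine ⟨eventually_residual_hasAllUniformLimits hE hΛ
    (fun n f₀ ε hε => HardySpace.eventually_norm_taylorSum_sub_lt n f₀ hε)
    fun f₀ V hV g ε hε => ?_, eventually_residual_hasAllUniformLimits hE hΛ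
    (fun n f₀ ε hε => eventually_norm_fourierSum_sub_lt n f₀ hε) fun f₀ V hV g ε hε => ?_⟩
  · obtain ⟨δ, hδ, hV⟩ := Metric.mem_nhds_iff.1 hV
    obtain ⟨f, hf, h⟩ := HardySpace.exists_near_taylorSum_near hp hE hE0 f₀ g (half_pos hδ) hε
    refine ⟨f, hV ?_, h⟩
    rw [Metric.mem_ball, dist_eq_norm]
    linarith
  · obtain ⟨δ, hδ, hV⟩ := Metric.mem_nhds_iff.1 hV
    obtain ⟨f, hf, h⟩ := exists_near_fourierSum_near hp hE hE0 f₀ g hδ hε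
    exact ⟨f, hV (by rwa [Metric.mem_ball, dist_eq_norm]), h⟩
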